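/- **Theorem.** Let $k$ be a field, let $\Delta$ be a simplicial complex on a finite vertex set $V$, and let $R=k[x_v\mid v\in V]$. For $F\subseteq V$ write $x^F=\prod_{v\in F}x_v$. The facet ideal of a complex $\Gamma$ with vertices in $V$ is $\mathcal I(\Gamma)=(x^G\mid G \text{ a facet of }\Gamma)\subseteq R$. For a homogeneous ideal $I\subseteq R$ with minimal graded free resolution $\cdots\to\bigoplus_j R(-j)^{\beta_{1,j}(I)}\to\bigoplus_j R(-j)^{\beta_{0,j}(I)}\to I\to 0$, the numbers $\beta_{i,j}(I)$ $(i,j\ge 0)$ are its graded Betti numbers; moreover put $\beta_{-1,0}(I)=1$ and $\beta_{-1,j}(I)=0$ for $j>0$. For a monomial ideal $I$ let $\mathcal G(I)$ be its set of minimal monomial generators. If $J,K$ are nonzero monomial ideals, then $I=J+K$ is a *splitting* of $I$ if $\mathcal G(I)$ is the disjoint union of $\mathcal G(J)$ and $\mathcal G(K)$ and there is a function $\mathcal G(J\cap K)\to\mathcal G(J)\times\mathcal G(K)$, $w\mapsto(\phi(w),\psi(w))$, such that $w=\operatorname{lcm}(\phi(w),\psi(w))$ for all $w\in\mathcal G(J\cap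 K)$, and such that for every nonempty subset $S\subseteq\mathcal G(J\cap K)$ both $\operatorname{lcm}(\phi(S))$ and $\operatorname{lcm}(\psi(S))$ strictly divide $\operatorname{lcm}(S)$. Let $F$ be a facet of $\Delta$. * $\Delta'=\Delta\setminus F$ is the complex whose facets are the facets of $\Delta$ other than $F$. * $\operatorname{conn}_\Delta(F)$ is the complex whose facets are the facets $G$ of $\Delta$ for which there is a chain of facets $F=F_0,F_1,\dots,F_m=G$ of $\Delta$ with $F_t\cap F_{t+1}\neq\emptyset$ for all $t$. * $\Omega=\Delta\setminus\operatorname{conn}_\Delta(F)$ is the complex whose facets are the facets of $\Delta$ that are not facets of $\operatorname{conn}_\Delta(F)$. * If $G_1,\dots,G_p$ are the facets of $\operatorname{conn}_\Delta(F)$ other than $F$, then $\overline{\operatorname{conn}}_\Delta(F)$ is the complex whose facets are the inclusion-minimal sets among $G_1\setminus F,\dots,G_p\setminus F$. (A complex without facets has facet ideal $0$.) Call $F$ a *splitting facet* of $\Delta$ if $\mathcal I(\Delta)=J+K$ with $J=(x^F)$ and $K=\mathcal I(\Delta')$ is a splitting of $\mathcal I(\Delta)$. If $F$ is a splitting facet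 of $\Delta$, then for all $i\ge 1$ and $j\ge 0$ $$\beta_{i,j}(\mathcal I(\Delta))=\beta_{i,j}(\mathcal I(\Delta'))+\sum_{l_1=0}^{i}\ \sum_{l_2=0}^{j-|F|}\beta_{l_1-1,\,l_2}\big(\mathcal I(\overline{\operatorname{conn}}_\Delta(F))\big)\,\beta_{i-l_1-1,\;j-|F|-l_2}\big(\mathcal I(\Omega)\big),$$ where the inner sum is empty if $j<|F|$. -/

import Mathlib

/-! ### Simplicial complexes through their facets -/

namespace PreAbstractSimplicialComplex

/-- The facets of a simplicial complex: its maximal faces under inclusion. -/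
def IsFacet {V : Type*} (Δ : PreAbstractSimplicialComplex V) (F : Finset V) : Prop :=
  Maximal (fun G => G ∈ Δ.faces) F

/-- The simplicial complex `⟨F | F ∈ S⟩` generated by a family of finite sets. Its facets are the
(nonempty) maximal members of `S`, on a finite vertex set. -/
def generate {V : Type*} (S : Set (Finset V)) : PreAbstractSimplicialComplex V where
  faces := {G | G.Nonempty ∧ ∃ F ∈ S, G ⊆ F}
  isRelLowerSet_faces := by
    rintro G ⟨hG, F, hF, hGF⟩
    exact ⟨hG, fun H hHG hH => ⟨hH, F, hF, le_trans hHG hGF⟩⟩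

/-- `Δ \ F`: the complex obtained by removing `F` from the facet set of `Δ`. -/
def removeFacet {V : Type*} (Δ : PreAbstractSimplicialComplex V) (F : Finset V) :
    PreAbstractSimplicialComplex V :=
  generate {G | Δ.IsFacet G ∧ G ≠ F}

/-- `Δ \ Γ`: the complex obtained by removing from the facet set of `Δ` all facets of `Γ`. -/
def removeSubcomplex {V : Type*} (Δ Γ : PreAbstractSimplicialComplex V) :
    PreAbstractSimplicialComplex V :=
  generate {G | Δ.IsFacet G ∧ ¬ Γ.IsFacet G}

/-- Two facets `F` and `G` are connected if there is a chain of facets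
`F = F₀, F₁, …, Fₘ = G` of `Δ` in which consecutive members intersect. -/
def FacetsConnected {V : Type*} [DecidableEq V] (Δ : PreAbstractSimplicialComplex V)
    (F G : Finset V) : Prop :=
  Relation.ReflTransGen
    (fun A B => Δ.IsFacet A ∧ Δ.IsFacet B ∧ (A ∩ B).Nonempty) F G

/-- `conn_Δ(F)`: the connected component of `Δ` containing the facet `F`. -/
def conn {V : Type*} [DecidableEq V] (Δ : PreAbstractSimplicialComplex V) (F : Finset V) :
    PreAbstractSimplicialComplex V :=
  generate {G | Δ.IsFacet G ∧ Δ.FacetsConnected F G}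

/-- The reduced connected component of the facet `F`: if `conn_Δ(F) \ F = ⟨G₁, …, Gₚ⟩`, its facets
are the sets `Gᵢ \ F` that are minimal under inclusion among `G₁ \ F, …, Gₚ \ F`. (None of these is
empty, because the `Gᵢ` are facets different from the facet `F`.) -/
def reducedConn {V : Type*} [DecidableEq V] (Δ : PreAbstractSimplicialComplex V)
    (F : Finset V) : PreAbstractSimplicialComplex V :=
  generate {H | Minimal (fun H' => ∃ G, ((Δ.conn F).removeFacet F).IsFacet G ∧ H' = G \ F) H}

end PreAbstractSimplicialComplex

/-! ### Monomial ideals, facet ideals and splittings -/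

namespace MonomialSplitting

open MvPolynomial

/-- The square-free monomial `x^F = ∏_{v ∈ F} x_v`. -/
noncomputable def faceMonomial {V : Type*} (k : Type*) [Field k] (F : Finset V) :
    MvPolynomial V k :=
  ∏ v ∈ F, X v

/-- The facet ideal `𝓘(Δ) = (x^F | F a facet of Δ)` of `k[x_v | v ∈ V]`. -/
noncomputable def facetIdeal {V : Type*} (k : Type*) [Field k]
    (Δ : PreAbstractSimplicialComplex V) : Ideal (MvPolynomial V k) :=
  Ideal.span {p | ∃ F, Δ.IsFacet F ∧ p = faceMonomial k F}

/-- Monomial ideals: ideals generated by monomials. -/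
def IsMonomialIdeal {V k : Type*} [Field k] (I : Ideal (MvPolynomial V k)) : Prop :=
  ∃ S : Set (V →₀ ℕ), I = Ideal.span ((fun a => monomial a (1 : k)) '' S)

/-- The set `𝓖(I)` of minimal monomial generators of a monomial ideal, a monomial being represented
by its exponent vector: these are the monomials in `I` that are minimal for divisibility
(divisibility of monomials is `≤` on exponent vectors, and `lcm` is `⊔`). -/
def minGens {V k : Type*} [Field k] (I : Ideal (MvPolynomial V k)) : Set (V →₀ ℕ) :=
  {a | Minimal (fun b => monomial b (1 : k) ∈ I) a}

/-- `I = J + K` is a splitting of the monomial ideal `I`. -/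
structure IsSplitting {V k : Type*} [Field k] (I J K : Ideal (MvPolynomial V k)) : Prop where
  isMonomial : IsMonomialIdeal I
  isMonomial_left : IsMonomialIdeal J
  isMonomial_right : IsMonomialIdeal K
  left_ne_bot : J ≠ ⊥
  right_ne_bot : K ≠ ⊥
  eq_add : I = J + K
  gens_eq : minGens I = minGens J ∪ minGens K
  gens_disjoint : Disjoint (minGens J) (minGens K)
  /-- The splitting function `w ↦ (φ w, ψ w)` on `𝓖(J ∩ K)`; the values of `φ` and `ψ` outside
  `𝓖(J ∩ K)` play no role. -/
  exists_splittingFunction : ∃ φ ψ : (V →₀ ℕ) → (V →₀ ℕ),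
    (∀ w ∈ minGens (J ⊓ K), φ w ∈ minGens J ∧ ψ w ∈ minGens K) ∧
    (∀ w ∈ minGens (J ⊓ K), w = φ w ⊔ ψ w) ∧
    (∀ S : Finset (V →₀ ℕ), S.Nonempty → (S : Set (V →₀ ℕ)) ⊆ minGens (J ⊓ K) →
      S.sup φ < S.sup id ∧ S.sup ψ < S.sup id)

/-- `F` is a splitting facet of `Δ`: it is a facet and `𝓘(Δ) = (x^F) + 𝓘(Δ \ F)` is a splitting. -/
def IsSplittingFacet {V : Type*} (k : Type*) [Field k]
    (Δ : PreAbstractSimplicialComplex V) (F : Finset V) : Prop :=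
  Δ.IsFacet F ∧
    IsSplitting (facetIdeal k Δ) (Ideal.span {faceMonomial k F}) (facetIdeal k (Δ.removeFacet F))

end MonomialSplitting

/-! ### Minimal graded free resolutions and graded Betti numbers -/

namespace GradedResolution

open MvPolynomial

/-- `f` is a homogeneous element of degree `n` of the graded free module `⨁ₐ R(-deg a)`,
`R = k[x_v | v ∈ V]` with its standard grading: every monomial `x^c` in the `a`-th coordinate of `f`
satisfies `|c| + deg a = n`. -/
def IsHomogeneousVec {V k : Type*} [Field k] {r : ℕ} (deg : Fin r → ℕ) (n : ℕ)
    (f : Fin r → MvPolynomial V k) : Prop :=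
  ∀ a, ∀ c ∈ (f a).support, c.degree + deg a = n

/-- A minimal graded free resolution
`⋯ → 𝓕₁ → 𝓕₀ → I → 0`, `𝓕ᵢ = ⨁_{a < rank i} R(-deg i a)`, of an ideal `I` of
`R = k[x_v | v ∈ V]`: an exact complex with homogeneous maps of degree `0`, such that the image of
`𝓕ᵢ₊₁ → 𝓕ᵢ` lies in `(x_v | v ∈ V) 𝓕ᵢ`. -/
structure MinimalResolution {V k : Type*} [Field k] (I : Ideal (MvPolynomial V k)) where
  rank : ℕ → ℕ
  deg : ∀ i, Fin (rank i) → ℕ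
  d : ∀ i, (Fin (rank (i + 1)) → MvPolynomial V k) →ₗ[MvPolynomial V k]
    (Fin (rank i) → MvPolynomial V k)
  aug : (Fin (rank 0) → MvPolynomial V k) →ₗ[MvPolynomial V k] MvPolynomial V k
  d_homogeneous : ∀ i n f, IsHomogeneousVec (deg (i + 1)) n f → IsHomogeneousVec (deg i) n (d i f)
  aug_homogeneous : ∀ n f, IsHomogeneousVec (deg 0) n f → (aug f).IsHomogeneous n
  range_aug : LinearMap.range aug = I
  exact_zero : LinearMap.range (d 0) = LinearMap.ker aug
  exact_succ : ∀ i, LinearMap.range (d (i + 1)) = LinearMap.ker (d i)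
  minimal : ∀ i f a, d i f a ∈ Ideal.span (Set.range (X : V → MvPolynomial V k))

/-- The number of summands `R(-j)` in homological degree `i` of the resolution. -/
def MinimalResolution.betti {V k : Type*} [Field k] {I : Ideal (MvPolynomial V k)}
    (ℱ : MinimalResolution I) (i j : ℕ) : ℕ :=
  (Finset.univ.filter fun a => ℱ.deg i a = j).card

/-! Existence of minimal graded free resolutions, so that graded Betti numbers are meaningful. -/

/-- The homogeneous component of degree `n` of an element of `⨁ₐ R(-deg a)`. -/
noncomputable def vecComponent {V k : Type*} [Field k] {r : ℕ} (deg : Fin r → ℕ) (n : ℕ)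
    (f : Fin r → MvPolynomial V k) : Fin r → MvPolynomial V k :=
  fun a => if deg a ≤ n then homogeneousComponent (n - deg a) (f a) else 0

theorem coeff_vecComponent {V k : Type*} [Field k] {r : ℕ} (deg : Fin r → ℕ) (n : ℕ)
    (f : Fin r → MvPolynomial V k) (a : Fin r) (c : V →₀ ℕ) :
    coeff c (vecComponent deg n f a) = if c.degree + deg a = n then coeff c (f a) else 0 := by
  unfold vecComponent
  split_ifs with h1 h2 h2
  · rw [coeff_homogeneousComponent, if_pos (by omega)]
  · rw [coeff_homogeneousComponent, if_neg (by omega)]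
  · omega
  · simp

theorem isHomogeneousVec_iff {V k : Type*} [Field k] {r : ℕ} (deg : Fin r → ℕ) (n : ℕ)
    (f : Fin r → MvPolynomial V k) :
    IsHomogeneousVec deg n f ↔ ∀ a c, coeff c (f a) ≠ 0 → c.degree + deg a = n := by
  simp [IsHomogeneousVec]

theorem isHomogeneousVec_vecComponent {V k : Type*} [Field k] {r : ℕ} (deg : Fin r → ℕ) (n : ℕ)
    (f : Fin r → MvPolynomial V k) : IsHomogeneousVec deg n (vecComponent deg n f) := by
  rw [isHomogeneousVec_iff]
  intro a c h
  rw [coeff_vecComponent] at h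
  by_contra h2
  exact h (if_neg h2)

theorem vecComponent_of_homogeneous {V k : Type*} [Field k] {r : ℕ} (deg : Fin r → ℕ) (m n : ℕ)
    (f : Fin r → MvPolynomial V k) (hf : IsHomogeneousVec deg n f) :
    vecComponent deg m f = if m = n then f else 0 := by
  rw [isHomogeneousVec_iff] at hf
  ext a c
  rw [coeff_vecComponent]
  by_cases h : coeff c (f a) = 0
  · split_ifs <;> simp [h]
  · have := hf a c h
    by_cases hm : m = n
    · rw [if_pos hm, if_pos (by omega)]
    · rw [if_neg hm, if_neg (by omega)]; simp

theorem vecComponent_sum {V k : Type*} [Field k] {r : ℕ} (deg : Fin r → ℕ) (n : ℕ)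
    {ι : Type*} (s : Finset ι) (f : ι → Fin r → MvPolynomial V k) :
    vecComponent deg n (∑ i ∈ s, f i) = ∑ i ∈ s, vecComponent deg n (f i) := by
  ext a c
  simp only [coeff_vecComponent, Finset.sum_apply, coeff_sum]
  split_ifs <;> simp

theorem exists_sum_vecComponent {V k : Type*} [Field k] {r : ℕ} (deg : Fin r → ℕ)
    (f : Fin r → MvPolynomial V k) :
    ∃ N, f = ∑ n ∈ Finset.range N, vecComponent deg n f := by
  refine ⟨(Finset.univ.sup fun a => (f a).totalDegree + deg a) + 1, ?_⟩
  ext a c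
  simp only [Finset.sum_apply, coeff_sum, coeff_vecComponent, Finset.sum_ite_eq,
    Finset.mem_range]
  by_cases h : coeff c (f a) = 0
  · simp [h]
  · rw [if_pos]
    have h1 : c.degree ≤ (f a).totalDegree := by
      have := le_totalDegree (mem_support_iff.mpr h)
      exact this
    have h2 := Finset.le_sup (f := fun a => (f a).totalDegree + deg a) (Finset.mem_univ a)
    exact Nat.lt_succ_of_le (le_trans (Nat.add_le_add_right h1 _) h2)

/-- Every homogeneous submodule of a finite graded free module is the image of a homogeneous map
from a finite graded free module whose kernel lies in `(x_v | v ∈ V)` times the source. -/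
theorem exists_minimal_cover {V k : Type*} [Finite V] [Field k] {r : ℕ} (deg : Fin r → ℕ)
    (N : Submodule (MvPolynomial V k) (Fin r → MvPolynomial V k))
    (hN : ∀ f ∈ N, ∀ n, vecComponent deg n f ∈ N) :
    ∃ (r' : ℕ) (deg' : Fin r' → ℕ) (d : (Fin r' → MvPolynomial V k) →ₗ[MvPolynomial V k]
      (Fin r → MvPolynomial V k)),
      (∀ n f, IsHomogeneousVec deg' n f → IsHomogeneousVec deg n (d f)) ∧
      LinearMap.range d = N ∧
      (∀ f ∈ LinearMap.ker d, ∀ n, vecComponent deg' n f ∈ LinearMap.ker d) ∧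
      (∀ f ∈ LinearMap.ker d, ∀ a, f a ∈ Ideal.span (Set.range (X : V → MvPolynomial V k))) := by
  classical
  have hex : ∃ r', ∃ (g : Fin r' → Fin r → MvPolynomial V k) (e : Fin r' → ℕ),
      (∀ a, IsHomogeneousVec deg (e a) (g a)) ∧
      Submodule.span (MvPolynomial V k) (Set.range g) = N := by
    have hspan : Submodule.span (MvPolynomial V k)
        {f | f ∈ N ∧ ∃ n, IsHomogeneousVec deg n f} = N := by
      apply le_antisymm
      · rw [Submodule.span_le]
        exact fun f hf => hf.1
      · intro f hf
        obtain ⟨M, hM⟩ := exists_sum_vecComponent deg f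
        rw [hM]
        exact Submodule.sum_mem _ fun n _ => Submodule.subset_span
          ⟨hN f hf n, n, isHomogeneousVec_vecComponent deg n f⟩
    have hfg : (Submodule.span (MvPolynomial V k)
        {f | f ∈ N ∧ ∃ n, IsHomogeneousVec deg n f}).FG := IsNoetherian.noetherian _
    obtain ⟨T, hT, hTspan⟩ := (Submodule.fg_span_iff_fg_span_finset_subset _).mp hfg
    have hT' : ∀ a : Fin T.card, ∃ n, IsHomogeneousVec deg n
        ((T.equivFin.symm a : T) : Fin r → MvPolynomial V k) :=
      fun a => (hT (T.equivFin.symm a).2).2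
    choose e he using hT'
    refine ⟨T.card, fun a => (T.equivFin.symm a : T), e, he, ?_⟩
    have : Set.range (fun a => ((T.equivFin.symm a : T) : Fin r → MvPolynomial V k)) = T := by
      ext f
      constructor
      · rintro ⟨a, rfl⟩
        exact (T.equivFin.symm a).2
      · intro hf
        exact ⟨T.equivFin ⟨f, hf⟩, by simp⟩
    rw [this, ← hTspan, hspan]
  obtain ⟨g, e, hg, hgN⟩ := Nat.find_spec hex
  have hmin := fun m (hm : m < Nat.find hex) => Nat.find_min hex hm
  generalize Nat.find hex = r' at g e hg hgN hmin
  have hd : ∀ n f, IsHomogeneousVec e n f →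
      IsHomogeneousVec deg n (Fintype.linearCombination (MvPolynomial V k) g f) := by
    intro n f hf a c hc
    rw [Fintype.linearCombination_apply, Finset.sum_apply] at hc
    have hc' := MvPolynomial.support_sum hc
    obtain ⟨b, -, hb⟩ := Finset.mem_biUnion.mp hc'
    rw [Pi.smul_apply, smul_eq_mul] at hb
    obtain ⟨c1, hc1, c2, hc2, rfl⟩ := Finset.mem_add.mp (support_mul _ _ hb)
    have h1 := hf b c1 hc1
    have h2 := hg b a c2 hc2
    rw [map_add]
    omega
  have hcomm : ∀ f n, vecComponent deg n (Fintype.linearCombination (MvPolynomial V k) g f) =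
      Fintype.linearCombination (MvPolynomial V k) g (vecComponent e n f) := by
    intro f n
    obtain ⟨M, hM⟩ := exists_sum_vecComponent e f
    conv_lhs => rw [hM]
    conv_rhs => rw [hM]
    rw [map_sum, vecComponent_sum, vecComponent_sum, map_sum]
    refine Finset.sum_congr rfl fun m _ => ?_
    have h1 := isHomogeneousVec_vecComponent e m f
    rw [vecComponent_of_homogeneous e n m _ h1, vecComponent_of_homogeneous deg n m _ (hd _ _ h1)]
    split_ifs <;> simp
  have hker : ∀ f ∈ LinearMap.ker (Fintype.linearCombination (MvPolynomial V k) g), ∀ n,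
      vecComponent e n f ∈ LinearMap.ker (Fintype.linearCombination (MvPolynomial V k) g) := by
    intro f hf n
    rw [LinearMap.mem_ker] at hf ⊢
    rw [← hcomm, hf]
    ext a c
    simp [coeff_vecComponent]
  refine ⟨r', e, Fintype.linearCombination (MvPolynomial V k) g, hd, ?_, hker, ?_⟩
  · rw [Fintype.range_linearCombination, hgN]
  · intro f hf a
    have hcoeff : coeff 0 (f a) = 0 := by
      by_contra hne
      have hq := hker f hf (e a)
      have hqa : vecComponent e (e a) f a = C (coeff 0 (f a)) := by
        simp [vecComponent, homogeneousComponent_zero]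
      obtain ⟨s, rfl⟩ : ∃ s, r' = s + 1 := ⟨r' - 1, by have := a.2; omega⟩
      refine hmin s (by omega) ⟨fun b => g (a.succAbove b), fun b => e (a.succAbove b),
        fun b => hg _, ?_⟩
      have hga : g a ∈ Submodule.span (MvPolynomial V k)
          (Set.range fun b => g (a.succAbove b)) := by
        rw [LinearMap.mem_ker, Fintype.linearCombination_apply, Fin.sum_univ_succAbove _ a,
          hqa] at hq
        have h1 : (C (coeff 0 (f a)) : MvPolynomial V k) • g a ∈ Submodule.span (MvPolynomial V k)
            (Set.range fun b => g (a.succAbove b)) := by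
          rw [eq_neg_of_add_eq_zero_left hq]
          exact Submodule.neg_mem _ (Submodule.sum_mem _ fun b _ =>
            Submodule.smul_mem _ _ (Submodule.subset_span ⟨b, rfl⟩))
        have h2 := Submodule.smul_mem _ (C (coeff 0 (f a))⁻¹ : MvPolynomial V k) h1
        rwa [smul_smul, ← C_mul, inv_mul_cancel₀ hne, C_1, one_smul] at h2
      rw [← hgN]
      apply le_antisymm
      · apply Submodule.span_mono
        rintro _ ⟨b, rfl⟩
        exact ⟨_, rfl⟩
      · rw [Submodule.span_le]
        rintro _ ⟨b, rfl⟩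
        rcases Fin.eq_self_or_eq_succAbove a b with rfl | ⟨b', rfl⟩
        · exact hga
        · exact Submodule.subset_span ⟨b', rfl⟩
    have := (mem_ideal_span_X_image (x := f a) (s := (Set.univ : Set V))).mpr (by
      intro m hm
      by_contra hcon
      push Not at hcon
      have : m = 0 := by ext v; simpa using hcon v (Set.mem_univ v)
      rw [this, mem_support_iff] at hm
      exact hm hcoeff)
    rwa [Set.image_univ] at this

/-- A homogeneous ideal (in finitely many variables) has a minimal graded free resolution. -/
theorem nonempty_minimalResolution {V k : Type*} [Finite V] [Field k]
    (I : Ideal (MvPolynomial V k)) (hI : ∀ p ∈ I, ∀ n, homogeneousComponent n p ∈ I) :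
    Nonempty (MinimalResolution I) := by
  classical
  let St := Σ r : ℕ, {p : (Fin r → ℕ) × Submodule (MvPolynomial V k) (Fin r → MvPolynomial V k) //
    ∀ f ∈ p.2, ∀ n, vecComponent p.1 n f ∈ p.2}
  have key : ∀ S : St, ∃ (S' : St) (d : (Fin S'.1 → MvPolynomial V k) →ₗ[MvPolynomial V k]
      (Fin S.1 → MvPolynomial V k)),
      (∀ n f, IsHomogeneousVec S'.2.1.1 n f → IsHomogeneousVec S.2.1.1 n (d f)) ∧
      LinearMap.range d = S.2.1.2 ∧ LinearMap.ker d = S'.2.1.2 ∧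
      (∀ f ∈ S'.2.1.2, ∀ a, f a ∈ Ideal.span (Set.range (X : V → MvPolynomial V k))) := by
    rintro ⟨r, ⟨deg, N⟩, hN⟩
    obtain ⟨r', deg', d, h1, h2, h3, h4⟩ := exists_minimal_cover deg N hN
    exact ⟨⟨r', ⟨deg', LinearMap.ker d⟩, h3⟩, d, h1, h2, rfl, h4⟩
  choose nxt d hd hrange hker hmin using key
  let S₀ : St := ⟨1, ⟨fun _ => 0, Submodule.comap
    (LinearMap.proj (R := MvPolynomial V k) (φ := fun _ : Fin 1 => MvPolynomial V k) 0) I⟩, by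
    intro f hf n
    simpa [vecComponent] using hI _ hf n⟩
  let S : ℕ → St := fun i => Nat.rec (nxt S₀) (fun _ T => nxt T) i
  refine ⟨{
    rank := fun i => (S i).1
    deg := fun i => (S i).2.1.1
    d := fun i => d (S i)
    aug := (LinearMap.proj (φ := fun _ => MvPolynomial V k) (0 : Fin 1)).comp (d S₀)
    d_homogeneous := fun i n f hf => hd (S i) n f hf
    aug_homogeneous := ?_
    range_aug := ?_
    exact_zero := ?_
    exact_succ := ?_
    minimal := ?_ }⟩
  · intro n f hf c hc
    have := hd S₀ n f hf (0 : Fin 1) c (mem_support_iff.mpr hc)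
    rw [Finsupp.degree_eq_weight_one] at this
    exact this
  · rw [LinearMap.range_comp, hrange]
    ext p
    simp only [S₀, Submodule.mem_map, Submodule.mem_comap]
    constructor
    · rintro ⟨f, hf, rfl⟩
      exact hf
    · intro hp
      exact ⟨fun _ => p, hp, rfl⟩
  · rw [show LinearMap.range (d (S 0)) = _ from hrange (S 0),
      show (S 0).2.1.2 = _ from (hker S₀).symm]
    ext f
    simp only [LinearMap.mem_ker, LinearMap.comp_apply, LinearMap.proj_apply]
    constructor
    · intro h
      rw [h]; rfl
    · intro h
      funext a
      obtain rfl : a = (0 : Fin 1) := Subsingleton.elim _ _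
      exact h
  · intro i
    rw [show LinearMap.range (d (S (i + 1))) = _ from hrange (S (i + 1))]
    exact (hker (S i)).symm
  · intro i f a
    cases i with
    | zero =>
      refine hmin S₀ _ ?_ a
      have : d (S 0) f ∈ LinearMap.range (d (S 0)) := ⟨f, rfl⟩
      rwa [hrange] at this
    | succ i =>
      refine hmin (S i) _ ?_ a
      have : d (S (i + 1)) f ∈ LinearMap.range (d (S (i + 1))) := ⟨f, rfl⟩
      rwa [hrange] at this

open Classical in
/-- The graded Betti number `β_{i,j}(I)`, `i ≥ 0`, of a homogeneous ideal `I`: the number of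
summands `R(-j)` in homological degree `i` of a minimal graded free resolution of `I`. Such a
resolution exists (`nonempty_minimalResolution`) and is unique up to isomorphism. The value for an
ideal without minimal graded free resolution is irrelevant. -/
noncomputable def gradedBetti {V k : Type*} [Field k] (I : Ideal (MvPolynomial V k))
    (i j : ℕ) : ℕ :=
  if h : Nonempty (MinimalResolution I) then h.some.betti i j else 0

/-- The graded Betti numbers `β_{i,j}(I)` for `i ≥ -1`, `j ≥ 0`, with the convention
`β_{-1,0}(I) = 1` and `β_{-1,j}(I) = 0` for `j > 0`. -/
noncomputable def extBetti {V k : Type*} [Field k] (I : Ideal (MvPolynomial V k)) :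
    ℤ → ℕ → ℕ
  | Int.ofNat i, j => gradedBetti I i j
  | Int.negSucc i, j => if i = 0 ∧ j = 0 then 1 else 0

end GradedResolution

/-!
# Graded Betti numbers of a facet ideal with a splitting facet

Write `K = 𝓘(Δ \ F)` and `L = (K : x^F)`. Since `𝓘(Δ) = K + (x^F)`, the cokernel of the injection
`x^F : (R/L)(-|F|) → R/K` is `R/𝓘(Δ)`, so the mapping cone of a lift of this map to the minimal
resolutions of `R/L` and `R/K` is a free resolution of `R/𝓘(Δ)`. Moreover `L` is the sum of the
facet ideals of the reduced connected component of `F` and of `Δ \ conn_Δ(F)`, which involve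
disjoint sets of variables, so the tensor product of the minimal resolutions of the two quotients
is the minimal resolution of `R/L`. Counting generators gives the formula as soon as the cone is
minimal, that is, as soon as the lift has no unit entries; the convention for `β_{-1,j}` accounts
for the generator of `R` in a resolution of a quotient of `R`.

This is what the splitting provides (`exists_degree_bound`, `Frame.exists_lift`). For an exponent
`a` of a monomial in `L`, let `c a` be the least common multiple of the `ψ w`, where `w` runs
through the minimal generators of `(x^F) ∩ K` that divide `x^(a + F)`. Then `x^(c a)` lies in `K`,
and `c a` strictly divides `a + F`. As `c` is monotone and the strand of the resolution of `R/K` in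
degree `c a` is exact, the lift can be chosen by induction so that a basis element of degree
`a ≠ 0` is mapped into the span of basis elements of degree at most `c a`, hence different from
`a + F`.

All resolutions are multigraded and are handled through their scalar matrices (`Frame`), for which
exactness is a statement about finite-dimensional vector spaces. Every finitely generated monomial
ideal has a frame, the tensor product of the frames of principal ideals; cancelling unit entries
one at a time makes it minimal (`Frame.exists_minimal_frame`). A minimal frame yields a minimal
graded free resolution (`Frame.toMinimalResolution`). Since graded Betti numbers do not depend on
the minimal resolution (`gradedBetti_eq`), they count the basis elements of any minimal frame
(`Frame.gradedBetti_eq_count`).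
-/

/-! ### Scalar frames of multigraded resolutions -/

namespace MonomialSplitting

open Matrix Kronecker

/-- A frame of a multigraded free resolution of `R/I`, where `I` is the monomial ideal whose
monomials have exponents in the upper set `U`. A multigraded map between free modules
`⨁ R(-deg j) → ⨁ R(-deg i)` has matrix entries `d i j • x ^ (deg j - deg i)` with scalars `d i j`
that vanish unless `deg i ≤ deg j`; only these scalars are recorded, for all homological degrees at
once. The strand of the resolution in multidegree `b` is the span of the basis elements of degree
at most `b`, so exactness is a condition on these subspaces. The basis element `base` spans the
term `R` in homological degree `0`. In the multidegrees `b ∉ U` the strand is spanned by `base`,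
because of `deg_mem`, and no condition is required there. -/
structure Frame (k : Type*) [Field k] {V : Type*} (U : Set (V →₀ ℕ)) (ι : Type)
    [Fintype ι] where
  homDeg : ι → ℕ
  deg : ι → V →₀ ℕ
  d : Matrix ι ι k
  base : ι
  homDeg_eq_zero_iff : ∀ i, homDeg i = 0 ↔ i = base
  deg_base : deg base = 0
  deg_mem : ∀ i, i ≠ base → deg i ∈ U
  homDeg_of_ne : ∀ i j, d i j ≠ 0 → homDeg i + 1 = homDeg j
  deg_le_of_ne : ∀ i j, d i j ≠ 0 → deg i ≤ deg j
  d_mul_d : d * d = 0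
  exact : ∀ b ∈ U, ∀ x : ι → k, (∀ i, x i ≠ 0 → deg i ≤ b) → d *ᵥ x = 0 →
    ∃ y : ι → k, (∀ i, y i ≠ 0 → deg i ≤ b) ∧ d *ᵥ y = x

namespace Frame

variable {k : Type*} [Field k] {V : Type*} {U U₁ U₂ : Set (V →₀ ℕ)} {ι κ : Type}

theorem exists_of_mulVec_ne_zero {m : Type*} [Fintype κ] {A : Matrix m κ k} {x : κ → k} {i : m}
    (h : (A *ᵥ x) i ≠ 0) : ∃ j, A i j ≠ 0 ∧ x j ≠ 0 := by
  obtain ⟨j, -, hj⟩ := Finset.exists_ne_zero_of_sum_ne_zero h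
  exact ⟨j, left_ne_zero_of_mul hj, right_ne_zero_of_mul hj⟩

variable [Fintype ι] [Fintype κ]

/-- A frame is minimal if its differential has no unit entries. -/
def IsMinimal (C : Frame k U ι) : Prop :=
  ∀ i j, C.d i j ≠ 0 → C.deg i ≠ C.deg j

theorem d_mulVec_d_mulVec (C : Frame k U ι) (x : ι → k) : C.d *ᵥ (C.d *ᵥ x) = 0 := by
  rw [Matrix.mulVec_mulVec, C.d_mul_d, Matrix.zero_mulVec]

theorem d_apply_base (C : Frame k U ι) (i : ι) : C.d i C.base = 0 := by
  by_contra h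
  have := C.homDeg_of_ne _ _ h
  rw [(C.homDeg_eq_zero_iff C.base).mpr rfl] at this
  omega

/-- Preimages of homogeneous elements may be chosen homogeneous in the homological grading. -/
theorem exists_homogeneous_preimage (C : Frame k U ι) {b : V →₀ ℕ} (hb : b ∈ U) (n : ℕ)
    (x : ι → k) (hx : ∀ i, x i ≠ 0 → C.deg i ≤ b) (hxn : ∀ i, x i ≠ 0 → C.homDeg i = n)
    (hdx : C.d *ᵥ x = 0) :
    ∃ y : ι → k, (∀ i, y i ≠ 0 → C.deg i ≤ b ∧ C.homDeg i = n + 1) ∧ C.d *ᵥ y = x := by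
  obtain ⟨y, hy, hdy⟩ := C.exact b hb x hx hdx
  refine ⟨fun i => if C.homDeg i = n + 1 then y i else 0, fun i hi => ?_, ?_⟩
  · have : C.homDeg i = n + 1 := by
      by_contra h
      exact hi (if_neg h)
    exact ⟨hy i fun h => hi (by simp [h]), this⟩
  · ext i
    by_cases hi : C.homDeg i = n
    · rw [← hdy]
      refine Finset.sum_congr rfl fun j _ => ?_
      change C.d i j * (if C.homDeg j = n + 1 then y j else 0) = C.d i j * y j
      by_cases hij : C.d i j = 0
      · simp [hij]
      · rw [if_pos (by rw [← C.homDeg_of_ne _ _ hij, hi])]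
    · have : x i = 0 := by
        by_contra h
        exact hi (hxn i h)
      rw [this]
      refine Finset.sum_eq_zero fun j _ => ?_
      change C.d i j * (if C.homDeg j = n + 1 then y j else 0) = 0
      by_cases hij : C.d i j = 0
      · simp [hij]
      · rw [if_neg (by rw [← C.homDeg_of_ne _ _ hij]; omega), mul_zero]

/-- The frame of the zero ideal. -/
def zero (k : Type*) [Field k] (V : Type*) : Frame k (∅ : Set (V →₀ ℕ)) Unit where
  homDeg _ := 0
  deg _ := 0
  d := 0
  base := ()
  homDeg_eq_zero_iff _ := by simp
  deg_base := rfl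
  deg_mem i hi := absurd rfl hi
  homDeg_of_ne i j h := absurd rfl h
  deg_le_of_ne i j h := absurd rfl h
  d_mul_d := by simp
  exact b hb := absurd hb (by simp)

/-- The frame of the principal ideal generated by `x ^ m`. -/
def principal (k : Type*) [Field k] {V : Type*} (m : V →₀ ℕ) : Frame k (Set.Ici m) Bool where
  homDeg i := if i then 1 else 0
  deg i := if i then m else 0
  d := Matrix.of fun i j => if i = false ∧ j = true then 1 else 0
  base := false
  homDeg_eq_zero_iff i := by cases i <;> simp
  deg_base := by simp
  deg_mem i hi := by cases i <;> simp_all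
  homDeg_of_ne i j h := by cases i <;> cases j <;> simp_all
  deg_le_of_ne i j h := by cases i <;> cases j <;> simp_all
  d_mul_d := by
    ext i j
    cases i <;> cases j <;> simp [Matrix.mul_apply]
  exact b hb x hx h := by
    refine ⟨fun i => if i then x false else 0, ?_, ?_⟩
    · intro i hi
      cases i
      · simp at hi
      · simpa using hb
    · have := congrFun h false
      ext i
      cases i <;> simp_all [Matrix.mulVec, dotProduct]

/-! ### Tensor products of frames -/

/-- An exactness criterion for total complexes: if `D` is a differential on `κ → W` that is
triangular for the filtration by `h`, with diagonal parts proportional to `δ`, and `δ` is exact on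
the subspaces `S j`, then `D` is exact. -/
theorem exists_preimage_of_triangular {W : Type*} [AddCommGroup W] [Module k W]
    (h : κ → ℕ) (D : (κ → W) → (κ → W)) (hsub : ∀ z w, D (z - w) = D z - D w)
    (hDD : ∀ z, D (D z) = 0) (δ : W → W) (u : κ → k) (hu : ∀ j, u j ≠ 0)
    (hδs : ∀ (c : k) w, δ (c • w) = c • δ w)
    (S : κ → Submodule k W) (hS : ∀ z, (∀ j, z j ∈ S j) → ∀ j, D z j ∈ S j)
    (hD : ∀ z j, (∀ l, h j < h l → z l = 0) → D z j = u j • δ (z j))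
    (hδ : ∀ j, ∀ w ∈ S j, δ w = 0 → ∃ y ∈ S j, δ y = w)
    (z : κ → W) (hz : ∀ j, z j ∈ S j) (hDz : D z = 0) :
    ∃ y : κ → W, (∀ j, y j ∈ S j) ∧ D y = z := by
  classical
  have hD0 : D 0 = 0 := by simpa using hsub 0 0
  have hδ0 : δ 0 = 0 := by simpa using hδs 0 0
  have main : ∀ n : ℕ, ∀ z : κ → W, (∀ j, z j ∈ S j) → D z = 0 → (∀ j, n ≤ h j → z j = 0) →
      ∃ y : κ → W, (∀ j, y j ∈ S j) ∧ D y = z := by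
    intro n
    induction n with
    | zero =>
      intro z _ _ h0
      exact ⟨0, fun j => Submodule.zero_mem _, by rw [hD0]; ext j; exact (h0 j (zero_le)).symm⟩
    | succ n ih =>
      intro z hz hDz hn
      -- the top coefficients of a cycle are `δ`-cycles, hence can be removed
      have htop : ∀ j, h j = n → ∃ y ∈ S j, δ y = z j := by
        intro j hj
        refine hδ j _ (hz j) ?_
        have h1 := hD z j fun l hl => hn l (by omega)
        rw [hDz] at h1
        exact (smul_eq_zero.mp h1.symm).resolve_left (hu j)
      choose! y hyS hy using htop
      let y' : κ → W := fun j => if h j = n then (u j)⁻¹ • y j else 0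
      have hy'S : ∀ j, y' j ∈ S j := by
        intro j
        by_cases hj : h j = n
        · simp only [y', if_pos hj]
          exact Submodule.smul_mem _ _ (hyS j hj)
        · simp only [y', if_neg hj, Submodule.zero_mem]
      have hDy' : ∀ j, n ≤ h j → D y' j = z j := by
        intro j hj
        rw [hD y' j fun l hl => if_neg (by omega)]
        by_cases hj' : h j = n
        · simp only [y', if_pos hj']
          rw [hδs, smul_smul, mul_inv_cancel₀ (hu j), one_smul, hy j hj']
        · simp only [y', if_neg hj']
          rw [hδ0, smul_zero, hn j (by omega)]
      obtain ⟨w, hwS, hw⟩ := ih (z - D y') (fun j => Submodule.sub_mem _ (hz j) (hS _ hy'S j))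
        (by rw [hsub, hDz, hDD, sub_zero]) (fun j hj => by simp [hDy' j hj])
      refine ⟨w - -y', fun j => Submodule.sub_mem _ (hwS j) (Submodule.neg_mem _ (hy'S j)), ?_⟩
      have hneg : D (-y') = - D y' := by
        have := hsub 0 y'
        rwa [hD0, zero_sub, zero_sub] at this
      rw [hsub, hw, hneg]
      abel
  refine main (Finset.univ.sup h + 1) z hz hDz fun j hj => ?_
  have := Finset.le_sup (f := h) (Finset.mem_univ j)
  omega

/-- The coefficient vectors supported in degrees at most `b` if `e ≤ b`, and the zero subspace
otherwise. In a tensor product, `e` is the degree of a basis element of one factor, and this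
subspace consists of its coefficients in the strand of degree `b`. -/
def strand (k : Type*) [Field k] (deg : ι → V →₀ ℕ) (e b : V →₀ ℕ) : Submodule k (ι → k) where
  carrier := {x | ∀ i, x i ≠ 0 → deg i ≤ b ∧ e ≤ b}
  zero_mem' i hi := absurd rfl hi
  add_mem' := by
    intro x y hx hy i hi
    by_cases h : x i = 0
    · exact hy i fun h' => hi (by simp [h, h'])
    · exact hx i h
  smul_mem' := by
    intro c x hx i hi
    exact hx i fun h => hi (by simp [h])

theorem exact_strand (C : Frame k U ι) {b : V →₀ ℕ} (hb : b ∈ U) (e : V →₀ ℕ) (x : ι → k)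
    (hx : x ∈ strand k C.deg e b) (h : C.d *ᵥ x = 0) :
    ∃ y ∈ strand k C.deg e b, C.d *ᵥ y = x := by
  by_cases he : e ≤ b
  · obtain ⟨y, hy, rfl⟩ := C.exact b hb x (fun i hi => (hx i hi).1) h
    exact ⟨y, fun i hi => ⟨hy i hi, he⟩, rfl⟩
  · refine ⟨0, Submodule.zero_mem _, ?_⟩
    rw [Matrix.mulVec_zero]
    ext i
    by_contra hi
    exact he (hx i (Ne.symm hi)).2

/-- The differential of the tensor product, with the sign on the second factor. -/
def tensorD [DecidableEq ι] [DecidableEq κ] (C : Frame k U₁ ι) (D : Frame k U₂ κ) :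
    Matrix (ι × κ) (ι × κ) k :=
  C.d ⊗ₖ Matrix.diagonal (fun j => (-1) ^ D.homDeg j) + (1 : Matrix ι ι k) ⊗ₖ D.d

variable [DecidableEq ι] [DecidableEq κ]

theorem tensorD_apply_ne_zero (C : Frame k U₁ ι) (D : Frame k U₂ κ) {p q : ι × κ}
    (h : tensorD C D p q ≠ 0) :
    (C.d p.1 q.1 ≠ 0 ∧ p.2 = q.2) ∨ (p.1 = q.1 ∧ D.d p.2 q.2 ≠ 0) := by
  by_contra hcon
  push Not at hcon
  refine h ?_
  simp only [tensorD, Matrix.add_apply, Matrix.kroneckerMap_apply, Matrix.diagonal_apply,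
    Matrix.one_apply]
  by_cases h1 : C.d p.1 q.1 = 0 <;> by_cases h2 : p.1 = q.1
  · simp [h1, hcon.2 h2]
  · simp [h1, h2]
  · simp [hcon.1 h1, hcon.2 h2]
  · simp [hcon.1 h1, h2]

theorem tensorD_mulVec (C : Frame k U₁ ι) (D : Frame k U₂ κ) (z : ι × κ → k) (i : ι) (j : κ) :
    (tensorD C D *ᵥ z) (i, j) =
      (-1) ^ D.homDeg j * (C.d *ᵥ fun i' => z (i', j)) i + (D.d *ᵥ fun j' => z (i, j')) j := by
  rw [tensorD, Matrix.add_mulVec, Pi.add_apply]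
  simp only [Matrix.mulVec, dotProduct,
    Fintype.sum_prod_type, Matrix.kroneckerMap_apply, Matrix.diagonal_apply, Matrix.one_apply]
  congr 1
  · rw [Finset.mul_sum]
    refine Finset.sum_congr rfl fun i' _ => ?_
    rw [Finset.sum_eq_single j (by intro b _ hb; simp [Ne.symm hb]) (by simp)]
    rw [if_pos rfl]; ring
  · rw [Finset.sum_eq_single i (by intro b _ hb; simp [Ne.symm hb]) (by simp)]
    simp

theorem tensorD_mul_tensorD (C : Frame k U₁ ι) (D : Frame k U₂ κ) :
    tensorD C D * tensorD C D = 0 := by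
  have hsign : (Matrix.diagonal fun j => (-1) ^ D.homDeg j) * D.d +
      D.d * (Matrix.diagonal fun j => (-1) ^ D.homDeg j) = 0 := by
    ext i j
    rw [Matrix.add_apply, Matrix.diagonal_mul, Matrix.mul_diagonal, Matrix.zero_apply]
    by_cases h : D.d i j = 0
    · simp [h]
    · rw [← D.homDeg_of_ne i j h, pow_succ]; ring
  rw [tensorD, mul_add, add_mul, add_mul, ← Matrix.mul_kronecker_mul, ← Matrix.mul_kronecker_mul,
    ← Matrix.mul_kronecker_mul, ← Matrix.mul_kronecker_mul, C.d_mul_d, D.d_mul_d, Matrix.mul_one,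
    Matrix.one_mul, Matrix.zero_kronecker, Matrix.kronecker_zero, zero_add, add_zero,
    ← Matrix.kronecker_add, add_comm, hsign, Matrix.kronecker_zero]

/-- The tensor product over `k` of frames of two monomial ideals, with least common multiples as
degrees, is a frame of the sum of the ideals: its strands are the tensor products of the strands of
the factors, and a tensor product of complexes over a field is exact as soon as one factor is. -/
noncomputable def tensor (C : Frame k U₁ ι) (D : Frame k U₂ κ) (h₁ : IsUpperSet U₁)
    (h₂ : IsUpperSet U₂) : Frame k (U₁ ∪ U₂) (ι × κ) where
  homDeg p := C.homDeg p.1 + D.homDeg p.2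
  deg p := C.deg p.1 ⊔ D.deg p.2
  d := tensorD C D
  base := (C.base, D.base)
  homDeg_eq_zero_iff p := by
    rw [Nat.add_eq_zero_iff, C.homDeg_eq_zero_iff, D.homDeg_eq_zero_iff, Prod.ext_iff]
  deg_base := by simp [C.deg_base, D.deg_base]
  deg_mem p hp := by
    by_cases h : p.1 = C.base
    · exact Or.inr (h₂ le_sup_right (D.deg_mem _ fun h' => hp (Prod.ext h h')))
    · exact Or.inl (h₁ le_sup_left (C.deg_mem _ h))
  homDeg_of_ne p q h := by
    rcases tensorD_apply_ne_zero C D h with ⟨h, h'⟩ | ⟨h', h⟩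
    · have := C.homDeg_of_ne _ _ h
      rw [h']; omega
    · have := D.homDeg_of_ne _ _ h
      rw [h']; omega
  deg_le_of_ne p q h := by
    rcases tensorD_apply_ne_zero C D h with ⟨h, h'⟩ | ⟨h', h⟩
    · rw [h']
      exact sup_le_sup_right (C.deg_le_of_ne _ _ h) _
    · rw [h']
      exact sup_le_sup_left (D.deg_le_of_ne _ _ h) _
  d_mul_d := tensorD_mul_tensorD C D
  exact b hb z hz hdz := by
    have hstr : ∀ w : ι × κ → k, (∀ p, w p ≠ 0 → C.deg p.1 ⊔ D.deg p.2 ≤ b) →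
        ∀ p, (tensorD C D *ᵥ w) p ≠ 0 → C.deg p.1 ⊔ D.deg p.2 ≤ b := by
      intro w hw p hp
      obtain ⟨q, hpq, hq⟩ := exists_of_mulVec_ne_zero hp
      refine le_trans ?_ (hw q hq)
      rcases tensorD_apply_ne_zero C D hpq with ⟨h, h'⟩ | ⟨h', h⟩
      · rw [h']
        exact sup_le_sup_right (C.deg_le_of_ne _ _ h) _
      · rw [h']
        exact sup_le_sup_left (D.deg_le_of_ne _ _ h) _
    have hDD : ∀ w, tensorD C D *ᵥ (tensorD C D *ᵥ w) = 0 := by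
      intro w
      rw [Matrix.mulVec_mulVec, tensorD_mul_tensorD, Matrix.zero_mulVec]
    rcases hb with hb | hb
    · obtain ⟨y, hy, hyz⟩ := exists_preimage_of_triangular D.homDeg
        (fun (w : κ → ι → k) j i => (tensorD C D *ᵥ fun p => w p.2 p.1) (i, j))
        (by
          intro w w'
          ext j i
          have : (fun p : ι × κ => (w - w') p.2 p.1) =
            (fun p => w p.2 p.1) - (fun p => w' p.2 p.1) := rfl
          rw [this, Matrix.mulVec_sub]
          rfl)
        (by
          intro w
          ext j i
          exact congrFun (hDD _) (i, j))
        (fun w => C.d *ᵥ w) (fun j => (-1) ^ D.homDeg j) (fun j => by simp)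
        (fun c w => Matrix.mulVec_smul _ _ _)
        (fun j => strand k C.deg (D.deg j) b)
        (by
          intro w hw j i hi
          exact sup_le_iff.mp (hstr _ (fun p hp => sup_le_iff.mpr (hw p.2 p.1 hp)) (i, j) hi))
        (by
          intro w j hw
          ext i
          rw [tensorD_mulVec]
          have : (D.d *ᵥ fun j' => w j' i) j = 0 := by
            by_contra hne
            obtain ⟨l, hl, hwl⟩ := exists_of_mulVec_ne_zero hne
            have := D.homDeg_of_ne _ _ hl
            exact hwl (by rw [hw l (by omega)]; rfl)
          rw [this, add_zero]
          rfl)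
        (fun j w hw h => C.exact_strand hb _ w hw h)
        (fun j i => z (i, j))
        (fun j i hi => sup_le_iff.mp (hz (i, j) hi))
        (by
          ext j i
          exact congrFun hdz (i, j))
      refine ⟨fun p => y p.2 p.1, fun p hp => sup_le_iff.mpr (hy p.2 p.1 hp), ?_⟩
      ext ⟨i, j⟩
      exact congrFun (congrFun hyz j) i
    · obtain ⟨y, hy, hyz⟩ := exists_preimage_of_triangular C.homDeg
        (fun (w : ι → κ → k) i j => (tensorD C D *ᵥ fun p => w p.1 p.2) (i, j))
        (by
          intro w w'
          ext i j
          have : (fun p : ι × κ => (w - w') p.1 p.2) =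
            (fun p => w p.1 p.2) - (fun p => w' p.1 p.2) := rfl
          rw [this, Matrix.mulVec_sub]
          rfl)
        (by
          intro w
          ext i j
          exact congrFun (hDD _) (i, j))
        (fun w => D.d *ᵥ w) (fun _ => (1 : k)) (fun j => one_ne_zero)
        (fun c w => Matrix.mulVec_smul _ _ _)
        (fun i => strand k D.deg (C.deg i) b)
        (by
          intro w hw i j hi
          exact (sup_le_iff.mp (hstr _ (fun p hp => sup_le_iff.mpr (hw p.1 p.2 hp).symm)
            (i, j) hi)).symm)
        (by
          intro w i hw
          ext j
          rw [tensorD_mulVec]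
          have : (C.d *ᵥ fun i' => w i' j) i = 0 := by
            by_contra hne
            obtain ⟨l, hl, hwl⟩ := exists_of_mulVec_ne_zero hne
            have := C.homDeg_of_ne _ _ hl
            exact hwl (by rw [hw l (by omega)]; rfl)
          rw [this, mul_zero, zero_add, one_smul])
        (fun j w hw h => D.exact_strand hb _ w hw h)
        (fun i j => z (i, j))
        (fun i j hi => (sup_le_iff.mp (hz (i, j) hi)).symm)
        (by
          ext i j
          exact congrFun hdz (i, j))
      refine ⟨fun p => y p.1 p.2, fun p hp => sup_le_iff.mpr (hy p.1 p.2 hp).symm, ?_⟩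
      ext ⟨i, j⟩
      exact congrFun (congrFun hyz i) j

theorem sup_eq_add_of_disjoint {a b : V →₀ ℕ} (h : ∀ v, a v = 0 ∨ b v = 0) : a ⊔ b = a + b := by
  ext v
  rcases h v with h | h <;> simp [h]

/-- If the degrees of two minimal frames involve disjoint sets of variables, then their tensor
product is minimal. -/
theorem IsMinimal.tensor {C : Frame k U₁ ι} {D : Frame k U₂ κ} (hC : C.IsMinimal)
    (hD : D.IsMinimal) (h₁ : IsUpperSet U₁) (h₂ : IsUpperSet U₂)
    (hdisj : ∀ i j v, C.deg i v = 0 ∨ D.deg j v = 0) : (C.tensor D h₁ h₂).IsMinimal := by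
  intro p q hpq heq
  change C.deg p.1 ⊔ D.deg p.2 = C.deg q.1 ⊔ D.deg q.2 at heq
  rw [sup_eq_add_of_disjoint (hdisj _ _), sup_eq_add_of_disjoint (hdisj _ _)] at heq
  rcases tensorD_apply_ne_zero C D hpq with ⟨h, h'⟩ | ⟨h', h⟩
  · rw [h'] at heq
    exact hC _ _ h (add_right_cancel heq)
  · rw [h'] at heq
    exact hD _ _ h (add_left_cancel heq)

/-! ### Minimal frames -/

theorem sum_eq_sum_subtype_add_add {M : Type*} [AddCommMonoid M] {p q : ι} (hpq : p ≠ q)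
    (f : ι → M) : ∑ i, f i = (∑ i : {i // i ≠ p ∧ i ≠ q}, f i) + f p + f q := by
  have h : (Finset.univ.filter fun i => i ≠ p ∧ i ≠ q) = (Finset.univ.erase q).erase p := by
    ext i
    simp
  rw [← Finset.sum_subtype (Finset.univ.filter fun i => i ≠ p ∧ i ≠ q) (by simp) f, h,
    Finset.sum_erase_add _ _ (by simp [hpq]), Finset.sum_erase_add _ _ (by simp)]

/-- The differential induced on the quotient by `e_q` and `d e_q`, where `d p q` is a unit: the
basis elements `e_p` and `e_q` are cancelled. -/
def cancelD {ι : Type*} (d : Matrix ι ι k) (p q : ι) :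
    Matrix {i // i ≠ p ∧ i ≠ q} {i // i ≠ p ∧ i ≠ q} k :=
  Matrix.of fun i j => d i j - d i q * d p j / d p q

theorem cancelD_ne_zero {ι : Type*} {d : Matrix ι ι k} {p q : ι} {i j : {i // i ≠ p ∧ i ≠ q}}
    (h : cancelD d p q i j ≠ 0) : d i j ≠ 0 ∨ (d i q ≠ 0 ∧ d p j ≠ 0) := by
  by_contra! hcon
  refine h ?_
  rw [cancelD, Matrix.of_apply, hcon.1]
  by_cases h' : d i q = 0
  · simp [h']
  · simp [hcon.2 h']

/-- On a vector `w` with `w p = 0` and `(d w) p = 0`, the cancelled differential agrees with the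
original one. -/
theorem cancelD_mulVec {d : Matrix ι ι k} {p q : ι} (hne : p ≠ q) (hpq : d p q ≠ 0) (w : ι → k)
    (hw : w p = 0) (hdw : (d *ᵥ w) p = 0) :
    (cancelD d p q *ᵥ fun i => w i) = fun i : {i // i ≠ p ∧ i ≠ q} => (d *ᵥ w) i := by
  have hp : ∑ j : {i // i ≠ p ∧ i ≠ q}, d p j * w j = - (d p q * w q) := by
    have := sum_eq_sum_subtype_add_add hne fun j => d p j * w j
    rw [show ∑ j, d p j * w j = 0 from hdw, hw, mul_zero, add_zero] at this
    linear_combination -this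
  ext i
  have hi := sum_eq_sum_subtype_add_add hne fun j => d i j * w j
  rw [hw, mul_zero, add_zero] at hi
  change ∑ j : {i // i ≠ p ∧ i ≠ q}, (d i j - d i q * d p j / d p q) * w j = ∑ j, d i j * w j
  rw [hi]
  have : ∀ j : {i // i ≠ p ∧ i ≠ q}, (d i j - d i q * d p j / d p q) * w j =
      d i j * w j - d i q / d p q * (d p j * w j) := fun j => by ring
  simp only [this, Finset.sum_sub_distrib, ← Finset.mul_sum, hp]
  field_simp
  ring

/-- Every vector on the remaining basis elements lifts to a `w` with `w p = 0` and `(d w) p = 0`. -/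
theorem exists_lift_cancel {d : Matrix ι ι k} {p q : ι} (hne : p ≠ q) (hpq : d p q ≠ 0)
    (x : {i // i ≠ p ∧ i ≠ q} → k) : ∃ w : ι → k, (fun i : {i // i ≠ p ∧ i ≠ q} => w i) = x ∧
      w p = 0 ∧ (d *ᵥ w) p = 0 ∧ (w q ≠ 0 → ∃ j : {i // i ≠ p ∧ i ≠ q}, d p j ≠ 0 ∧ x j ≠ 0) := by
  refine ⟨fun i => if h : i ≠ p ∧ i ≠ q then x ⟨i, h⟩ else
    if i = q then - (∑ j : {i // i ≠ p ∧ i ≠ q}, d p j * x j) / d p q else 0, ?_, ?_, ?_, ?_⟩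
  · ext i
    simp [i.2]
  · simp [hne]
  · change ∑ j, d p j * _ = 0
    rw [sum_eq_sum_subtype_add_add hne]
    have : ∀ j : {i // i ≠ p ∧ i ≠ q}, d p j * (if h : (j : ι) ≠ p ∧ (j : ι) ≠ q then x ⟨j, h⟩ else
      if (j : ι) = q then - (∑ j : {i // i ≠ p ∧ i ≠ q}, d p j * x j) / d p q else 0) =
        d p j * x j := fun j => by rw [dif_pos j.2]
    simp only [this]
    simp only [ne_eq, not_true_eq_false, false_and, and_false, dite_false, hne, if_false, if_true]
    field_simp
    ring
  · intro h
    simp only [ne_eq, not_true_eq_false, and_false, dite_false, if_true] at h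
    have h' : ∑ j : {i // i ≠ p ∧ i ≠ q}, d p j * x j ≠ 0 := fun h' => h (by rw [h']; simp)
    obtain ⟨j, -, hj⟩ := Finset.exists_ne_zero_of_sum_ne_zero h'
    exact ⟨j, left_ne_zero_of_mul hj, right_ne_zero_of_mul hj⟩

/-- Cancellation of two basis elements of equal degree that are joined by a unit entry of the
differential. The base element is never cancelled, because the ideal is proper. -/
def cancel (C : Frame k U ι) (hU : 0 ∉ U) (p q : ι) (hpq : C.d p q ≠ 0)
    (hdeg : C.deg p = C.deg q) : Frame k U {i // i ≠ p ∧ i ≠ q} :=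
  have hhom := C.homDeg_of_ne p q hpq
  have hne : p ≠ q := fun h => by rw [h] at hhom; omega
  have hq : q ≠ C.base := fun h => by rw [← C.homDeg_eq_zero_iff] at h; omega
  have hp : p ≠ C.base := fun h => hU (by
    have := C.deg_mem q hq
    rwa [← hdeg, h, C.deg_base] at this)
  { homDeg := fun i => C.homDeg i
    deg := fun i => C.deg i
    d := cancelD C.d p q
    base := ⟨C.base, hp.symm, hq.symm⟩
    homDeg_eq_zero_iff := fun i => by rw [C.homDeg_eq_zero_iff, Subtype.ext_iff]
    deg_base := C.deg_base
    deg_mem := fun i hi => C.deg_mem i fun h => hi (Subtype.ext h)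
    homDeg_of_ne := fun i j h => by
      rcases cancelD_ne_zero h with h | ⟨h1, h2⟩
      · exact C.homDeg_of_ne _ _ h
      · have h1 := C.homDeg_of_ne _ _ h1
        have h2 := C.homDeg_of_ne _ _ h2
        omega
    deg_le_of_ne := fun i j h => by
      rcases cancelD_ne_zero h with h | ⟨h1, h2⟩
      · exact C.deg_le_of_ne _ _ h
      · exact (C.deg_le_of_ne _ _ h1).trans (hdeg ▸ C.deg_le_of_ne _ _ h2)
    d_mul_d := by
      refine Matrix.ext_of_mulVec_single fun j => ?_
      rw [← Matrix.mulVec_mulVec, Matrix.zero_mulVec]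
      obtain ⟨w, hw, hwp, hdw, -⟩ := exists_lift_cancel hne hpq (Pi.single j 1)
      rw [← hw, cancelD_mulVec hne hpq w hwp hdw, cancelD_mulVec hne hpq _ hdw
        (by rw [C.d_mulVec_d_mulVec]; rfl), C.d_mulVec_d_mulVec]
      rfl
    exact := fun b hb x hx hdx => by
      obtain ⟨w, rfl, hwp, hdw, hwq⟩ := exists_lift_cancel hne hpq x
      rw [cancelD_mulVec hne hpq w hwp hdw] at hdx
      have hws : ∀ i, w i ≠ 0 → C.deg i ≤ b := by
        intro i hi
        by_cases hiq : i = q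
        · subst hiq
          obtain ⟨j, hj, hxj⟩ := hwq hi
          exact hdeg ▸ (C.deg_le_of_ne _ _ hj).trans (hx j hxj)
        · have hip : i ≠ p := by rintro rfl; exact hi hwp
          exact hx ⟨i, hip, hiq⟩ hi
      -- `d w` is concentrated at `q`, and `d (d w) = 0`, so it vanishes
      have hdw0 : C.d *ᵥ w = 0 := by
        have hsupp : ∀ i, i ≠ q → (C.d *ᵥ w) i = 0 := by
          intro i hiq
          by_cases hip : i = p
          · rw [hip, hdw]
          · exact congrFun hdx ⟨i, hip, hiq⟩
        have h0 : (C.d *ᵥ (C.d *ᵥ w)) p = C.d p q * (C.d *ᵥ w) q := by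
          change ∑ j, C.d p j * (C.d *ᵥ w) j = _
          exact Finset.sum_eq_single q (fun j _ hj => by rw [hsupp j hj, mul_zero]) (by simp)
        rw [C.d_mulVec_d_mulVec] at h0
        ext i
        by_cases hiq : i = q
        · rw [hiq]
          exact (mul_eq_zero.mp h0.symm).resolve_left hpq
        · exact hsupp i hiq
      obtain ⟨y, hy, hdy⟩ := C.exact b hb w hws hdw0
      -- subtract a multiple of `d e_q` in order to make the coefficient at `p` vanish
      let y' : ι → k := y - (y p / C.d p q) • (C.d *ᵥ Pi.single q 1)
      have hy'i : ∀ i, y' i = y i - y p / C.d p q * C.d i q := by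
        intro i
        simp [y']
      have hdy' : C.d *ᵥ y' = w := by
        rw [Matrix.mulVec_sub, Matrix.mulVec_smul, C.d_mulVec_d_mulVec, smul_zero, sub_zero, hdy]
      refine ⟨fun i => y' i, fun i hi => ?_, ?_⟩
      · dsimp only at hi
        rw [hy'i] at hi
        by_cases hyi : y i = 0
        · rw [hyi, zero_sub, neg_ne_zero] at hi
          have hyp : y p ≠ 0 := fun h => hi (by simp [h])
          exact (C.deg_le_of_ne _ _ (right_ne_zero_of_mul hi)).trans (hdeg ▸ hy p hyp)
        · exact hy i hyi
      · rw [cancelD_mulVec hne hpq y' (by rw [hy'i]; field_simp; ring) (by rw [hdy', hwp]), hdy'] }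

/-- Every frame of a proper monomial ideal cancels down to a minimal one. -/
theorem exists_isMinimal (hU : 0 ∉ U) {ι : Type} [Fintype ι] (C : Frame k U ι) :
    ∃ (κ : Type) (_ : Fintype κ) (D : Frame k U κ), D.IsMinimal ∧ ∀ j, ∃ i, D.deg j = C.deg i := by
  classical
  induction hn : Fintype.card ι using Nat.strong_induction_on generalizing ι with
  | _ n ih =>
    by_cases hC : C.IsMinimal
    · exact ⟨ι, _, C, hC, fun j => ⟨j, rfl⟩⟩
    · simp only [IsMinimal, not_forall, not_not] at hC
      obtain ⟨p, q, hpq, hdeg⟩ := hC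
      have hlt : Fintype.card {i // i ≠ p ∧ i ≠ q} < n := by
        rw [← hn]
        exact Fintype.card_subtype_lt (x := p) (by simp)
      obtain ⟨κ, _, D, hD, hdegD⟩ := ih _ hlt (C.cancel hU p q hpq hdeg) rfl
      refine ⟨κ, _, D, hD, fun j => ?_⟩
      obtain ⟨i, hi⟩ := hdegD j
      exact ⟨i, hi⟩

/-- The upper set of exponents of the monomials in the ideal generated by the `x ^ m`, `m ∈ S`. -/
def upset (S : Set (V →₀ ℕ)) : Set (V →₀ ℕ) := {b | ∃ m ∈ S, m ≤ b}

theorem isUpperSet_upset (S : Set (V →₀ ℕ)) : IsUpperSet (upset S) :=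
  fun _ _ h ⟨m, hm, hmb⟩ => ⟨m, hm, hmb.trans h⟩

/-- A finitely generated monomial ideal has a frame, whose degrees only involve the variables in
the generators. It is the tensor product of the frames of the principal ideals of the generators,
that is, the frame of the Taylor resolution. -/
theorem exists_frame (k : Type*) [Field k] (S : Finset (V →₀ ℕ)) :
    ∃ (ι : Type) (_ : Fintype ι) (C : Frame k (upset (S : Set (V →₀ ℕ))) ι),
      ∀ i v, C.deg i v ≠ 0 → ∃ m ∈ S, m v ≠ 0 := by
  classical
  induction S using Finset.induction_on with
  | empty =>
    have h : upset ((∅ : Finset (V →₀ ℕ)) : Set (V →₀ ℕ)) = ∅ := by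
      ext b
      simp [upset]
    rw [h]
    exact ⟨Unit, _, zero k V, fun i v hv => absurd rfl hv⟩
  | insert m S hm ih =>
    obtain ⟨ι, _, C, hC⟩ := ih
    have h : upset ((insert m S : Finset (V →₀ ℕ)) : Set (V →₀ ℕ)) =
        upset (S : Set (V →₀ ℕ)) ∪ Set.Ici m := by
      ext b
      simp [upset, or_comm]
    rw [h]
    refine ⟨ι × Bool, _, C.tensor (principal k m) (isUpperSet_upset _) (isUpperSet_Ici m), ?_⟩
    rintro ⟨i, j⟩ v hv
    change max (C.deg i v) ((principal k m).deg j v) ≠ 0 at hv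
    by_cases h1 : C.deg i v = 0
    · refine ⟨m, Finset.mem_insert_self _ _, fun h2 => hv ?_⟩
      cases j <;> simp [principal, h1, h2]
    · obtain ⟨m', hm', h'⟩ := hC i v h1
      exact ⟨m', Finset.mem_insert_of_mem hm', h'⟩

theorem exists_minimal_frame (k : Type*) [Field k] (S : Finset (V →₀ ℕ)) (hS : 0 ∉ S) :
    ∃ (ι : Type) (_ : Fintype ι) (C : Frame k (upset (S : Set (V →₀ ℕ))) ι), C.IsMinimal ∧
      ∀ i v, C.deg i v ≠ 0 → ∃ m ∈ S, m v ≠ 0 := by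
  obtain ⟨ι, _, C, hC⟩ := exists_frame k S
  have hU : 0 ∉ upset (S : Set (V →₀ ℕ)) := by
    rintro ⟨m, hm, hm0⟩
    exact hS (le_antisymm hm0 (zero_le) ▸ hm)
  obtain ⟨κ, _, D, hD, hdeg⟩ := exists_isMinimal hU C
  refine ⟨κ, _, D, hD, fun j v hv => ?_⟩
  obtain ⟨i, hi⟩ := hdeg j
  exact hC i v (hi ▸ hv)

/-! ### Mapping cones of frames -/

/-- The comparison map of frames that lifts a multiplication map `x ^ m : R/I₂ → R/I₁`. If `c` is a
monotone function taking exponents of `I₂` to exponents of `I₁`, then basis elements of degree `a`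
other than the base element can be mapped into degrees at most `c a`. -/
theorem exists_lift (C : Frame k U₁ κ) (D : Frame k U₂ ι) (c : (V →₀ ℕ) → (V →₀ ℕ))
    (hmono : Monotone c) (hc : ∀ a ∈ U₂, c a ∈ U₁) :
    ∃ μ : Matrix κ ι k, C.d * μ = μ * D.d ∧ (∀ j, μ j D.base = if j = C.base then 1 else 0) ∧
      (∀ j i, μ j i ≠ 0 → C.homDeg j = D.homDeg i) ∧
      (∀ j i, μ j i ≠ 0 → i ≠ D.base → C.deg j ≤ c (D.deg i)) := by
  -- the columns of `μ` are constructed by induction on the homological degree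
  have main : ∀ n : ℕ, ∃ f : ι → κ → k, f D.base = Pi.single C.base 1 ∧
      (∀ i, D.homDeg i ≤ n → ∀ j, f i j ≠ 0 →
        C.homDeg j = D.homDeg i ∧ (i ≠ D.base → C.deg j ≤ c (D.deg i))) ∧
      (∀ i, D.homDeg i ≤ n → C.d *ᵥ f i = ∑ l, D.d l i • f l) := by
    intro n
    induction n with
    | zero =>
      refine ⟨fun _ => Pi.single C.base 1, rfl, ?_, ?_⟩
      · intro i hi j hj
        have hi' : i = D.base := (D.homDeg_eq_zero_iff i).mp (by omega)
        have hj' : j = C.base := by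
          by_contra h
          exact hj (by simp [h])
        refine ⟨?_, fun h => absurd hi' h⟩
        rw [(D.homDeg_eq_zero_iff i).mpr hi', (C.homDeg_eq_zero_iff j).mpr hj']
      · intro i hi
        obtain rfl : i = D.base := (D.homDeg_eq_zero_iff i).mp (by omega)
        rw [Matrix.mulVec_single_one]
        ext j
        simp [d_apply_base]
    | succ n ih =>
      obtain ⟨f, hf0, hf1, hf2⟩ := ih
      have hstep : ∀ i, D.homDeg i = n + 1 → ∃ y : κ → k,
          (∀ j, y j ≠ 0 → C.deg j ≤ c (D.deg i) ∧ C.homDeg j = n + 1) ∧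
          C.d *ᵥ y = ∑ l, D.d l i • f l := by
        intro i hi
        have hib : i ≠ D.base := fun h => by
          rw [← D.homDeg_eq_zero_iff] at h; omega
        have hz : ∀ j, (∑ l, D.d l i • f l) j ≠ 0 → ∃ l, D.d l i ≠ 0 ∧ f l j ≠ 0 := by
          intro j hj
          rw [Finset.sum_apply] at hj
          obtain ⟨l, -, hl⟩ := Finset.exists_ne_zero_of_sum_ne_zero hj
          exact ⟨l, left_ne_zero_of_mul hl, right_ne_zero_of_mul hl⟩
        refine C.exists_homogeneous_preimage (hc _ (D.deg_mem i hib)) n _ ?_ ?_ ?_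
        · intro j hj
          obtain ⟨l, hl, hlj⟩ := hz j hj
          have hln := D.homDeg_of_ne _ _ hl
          obtain ⟨h1, h2⟩ := hf1 l (by omega) j hlj
          by_cases hlb : l = D.base
          · rw [(D.homDeg_eq_zero_iff l).mpr hlb, C.homDeg_eq_zero_iff] at h1
            rw [h1, C.deg_base]
            exact zero_le
          · exact (h2 hlb).trans (hmono (D.deg_le_of_ne _ _ hl))
        · intro j hj
          obtain ⟨l, hl, hlj⟩ := hz j hj
          have hln := D.homDeg_of_ne _ _ hl
          have := (hf1 l (by omega) j hlj).1
          omega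
        · rw [← Matrix.mulVecLin_apply, map_sum]
          have : ∀ l, C.d.mulVecLin (D.d l i • f l) = ∑ m, (D.d m l * D.d l i) • f m := by
            intro l
            by_cases hl : D.d l i = 0
            · simp [hl]
            · have hln := D.homDeg_of_ne _ _ hl
              rw [map_smul, Matrix.mulVecLin_apply, hf2 l (by omega), Finset.smul_sum]
              exact Finset.sum_congr rfl fun m _ => by rw [smul_smul, mul_comm]
          simp only [this]
          rw [Finset.sum_comm]
          refine Finset.sum_eq_zero fun m _ => ?_
          rw [← Finset.sum_smul, ← Matrix.mul_apply, D.d_mul_d, Matrix.zero_apply, zero_smul]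
      choose! y hy1 hy2 using hstep
      have hlow : ∀ i, D.homDeg i ≤ n + 1 → ∑ l, D.d l i • (if D.homDeg l ≤ n then f l else y l) =
          ∑ l, D.d l i • f l := by
        intro i hi
        refine Finset.sum_congr rfl fun l _ => ?_
        by_cases hl : D.d l i = 0
        · simp [hl]
        · have := D.homDeg_of_ne _ _ hl
          rw [if_pos (by omega)]
      refine ⟨fun i => if D.homDeg i ≤ n then f i else y i, ?_, ?_, ?_⟩
      · have := (D.homDeg_eq_zero_iff D.base).mpr rfl
        dsimp only
        rw [if_pos (by omega), hf0]
      · intro i hi j hj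
        dsimp only at hj
        by_cases hin : D.homDeg i ≤ n
        · rw [if_pos hin] at hj
          exact hf1 i hin j hj
        · rw [if_neg hin] at hj
          have hi' : D.homDeg i = n + 1 := by omega
          exact ⟨by rw [hi', (hy1 i hi' j hj).2], fun _ => (hy1 i hi' j hj).1⟩
      · intro i hi
        rw [hlow i hi]
        dsimp only
        by_cases hin : D.homDeg i ≤ n
        · rw [if_pos hin, hf2 i hin]
        · rw [if_neg hin, hy2 i (by omega)]
  obtain ⟨f, hf0, hf1, hf2⟩ := main (Finset.univ.sup D.homDeg)
  have hle : ∀ i, D.homDeg i ≤ Finset.univ.sup D.homDeg :=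
    fun i => Finset.le_sup (f := D.homDeg) (Finset.mem_univ i)
  refine ⟨Matrix.of fun j i => f i j, ?_, ?_, ?_, ?_⟩
  · ext j i
    have := congrFun (hf2 i (hle i)) j
    rw [Finset.sum_apply] at this
    rw [Matrix.mul_apply, Matrix.mul_apply]
    refine this.trans (Finset.sum_congr rfl fun l _ => ?_)
    simp [mul_comm]
  · intro j
    simp [hf0, Pi.single_apply]
  · exact fun j i h => (hf1 i (hle i) j h).1
  · exact fun j i h => (hf1 i (hle i) j h).2

/-- The mapping cone of a lift `μ` of the multiplication map `x ^ m : R/(I : x ^ m) → R/I` is a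
frame of `I + (x ^ m)`. -/
noncomputable def cone (C : Frame k U₁ κ) (D : Frame k U₂ ι) (m : V →₀ ℕ)
    (h₁ : IsUpperSet U₁) (hU : ∀ a, a ∈ U₂ ↔ a + m ∈ U₁) (μ : Matrix κ ι k)
    (hμd : C.d * μ = μ * D.d)
    (hμb : ∀ j, μ j D.base = if j = C.base then 1 else 0)
    (hμh : ∀ j i, μ j i ≠ 0 → C.homDeg j = D.homDeg i)
    (hμ : ∀ j i, μ j i ≠ 0 → C.deg j ≤ D.deg i + m) : Frame k (U₁ ∪ Set.Ici m) (κ ⊕ ι) where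
  homDeg := Sum.elim C.homDeg fun i => D.homDeg i + 1
  deg := Sum.elim C.deg fun i => D.deg i + m
  d := Matrix.fromBlocks C.d μ 0 (-D.d)
  base := Sum.inl C.base
  homDeg_eq_zero_iff := by
    rintro (j | i)
    · simp [C.homDeg_eq_zero_iff]
    · simp
  deg_base := by simp [C.deg_base]
  deg_mem := by
    rintro (j | i) h
    · exact Or.inl (C.deg_mem j fun h' => h (by rw [h']))
    · exact Or.inr (Set.mem_Ici.mpr (by simp))
  homDeg_of_ne := by
    rintro (j | i) (j' | i') h
    · exact C.homDeg_of_ne _ _ h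
    · simpa using hμh _ _ h
    · exact absurd rfl h
    · simpa using D.homDeg_of_ne _ _ (neg_ne_zero.mp h)
  deg_le_of_ne := by
    rintro (j | i) (j' | i') h
    · exact C.deg_le_of_ne _ _ h
    · exact hμ _ _ h
    · exact absurd rfl h
    · simpa using D.deg_le_of_ne _ _ (neg_ne_zero.mp h)
  d_mul_d := by
    rw [Matrix.fromBlocks_multiply]
    simp [C.d_mul_d, D.d_mul_d, hμd]
  exact b hb x hx hdx := by
    obtain ⟨x₁, x₂, rfl⟩ : ∃ x₁ x₂, x = Sum.elim x₁ x₂ :=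
      ⟨x ∘ Sum.inl, x ∘ Sum.inr, (Sum.elim_comp_inl_inr x).symm⟩
    have hd : ∀ (y₁ : κ → k) (y₂ : ι → k), Matrix.fromBlocks C.d μ 0 (-D.d) *ᵥ Sum.elim y₁ y₂ =
        Sum.elim (C.d *ᵥ y₁ + μ *ᵥ y₂) (-(D.d *ᵥ y₂)) := by
      intro y₁ y₂
      rw [Matrix.fromBlocks_mulVec]
      simp [Matrix.neg_mulVec]
    rw [hd] at hdx
    have h1 : C.d *ᵥ x₁ + μ *ᵥ x₂ = 0 := funext fun j => congrFun hdx (Sum.inl j)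
    have h2 : D.d *ᵥ x₂ = 0 := neg_eq_zero.mp (funext fun i => congrFun hdx (Sum.inr i))
    have hx₁ : ∀ j, x₁ j ≠ 0 → C.deg j ≤ b := fun j => hx (Sum.inl j)
    have hx₂ : ∀ i, x₂ i ≠ 0 → D.deg i + m ≤ b := fun i => hx (Sum.inr i)
    by_cases hbU : b ∈ U₁
    · obtain ⟨y₂, hy₂, hdy₂⟩ : ∃ y₂ : ι → k, (∀ i, y₂ i ≠ 0 → D.deg i + m ≤ b) ∧
          D.d *ᵥ y₂ = x₂ := by
        by_cases hmb : m ≤ b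
        · obtain ⟨a, rfl⟩ := exists_add_of_le hmb
          rw [add_comm] at hbU hx₂
          obtain ⟨y₂, hy₂, hdy₂⟩ := D.exact a ((hU a).mpr hbU) x₂
            (fun i hi => le_of_add_le_add_right (hx₂ i hi)) h2
          refine ⟨y₂, fun i hi => ?_, hdy₂⟩
          rw [add_comm m a]
          exact add_le_add_left (hy₂ i hi) m
        · refine ⟨0, fun i hi => absurd rfl hi, ?_⟩
          rw [Matrix.mulVec_zero]
          ext i
          by_contra hi
          exact hmb (le_trans (by simp) (hx₂ i (Ne.symm hi)))
      obtain ⟨y₁, hy₁, hdy₁⟩ := C.exact b hbU (x₁ + μ *ᵥ y₂)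
        (by
          intro j hj
          by_cases hxj : x₁ j = 0
          · rw [Pi.add_apply, hxj, zero_add] at hj
            obtain ⟨i, hi, hyi⟩ := exists_of_mulVec_ne_zero hj
            exact (hμ j i hi).trans (hy₂ i hyi)
          · exact hx₁ j hxj)
        (by rw [Matrix.mulVec_add, Matrix.mulVec_mulVec, hμd, ← Matrix.mulVec_mulVec, hdy₂, h1])
      refine ⟨Sum.elim y₁ (-y₂), ?_, ?_⟩
      · rintro (j | i) h
        · exact hy₁ j h
        · exact hy₂ i (neg_ne_zero.mp h)
      · rw [hd, hdy₁, Matrix.mulVec_neg, Matrix.mulVec_neg, hdy₂, neg_neg, add_neg_cancel_right]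
    · -- outside `U₁` both strands are spanned by the base elements, which `μ` identifies
      have hmb : m ≤ b := hb.resolve_left hbU
      obtain ⟨a, rfl⟩ := exists_add_of_le hmb
      rw [add_comm] at hbU hx₁ hx₂
      have hbase₁ : ∀ j, j ≠ C.base → x₁ j = 0 := fun j hj => by
        by_contra h
        exact hbU (h₁ (hx₁ j h) (C.deg_mem j hj))
      have hbase₂ : ∀ i, i ≠ D.base → x₂ i = 0 := fun i hi => by
        by_contra h
        exact hbU (h₁ (hx₂ i h) ((hU _).mp (D.deg_mem i hi)))
      have hx₂0 : x₂ D.base = 0 := by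
        have h0 := congrFun h1 C.base
        have hl : (C.d *ᵥ x₁) C.base = 0 := by
          by_contra hne
          obtain ⟨j, hj, hxj⟩ := exists_of_mulVec_ne_zero hne
          have : j = C.base := by
            by_contra h
            exact hxj (hbase₁ j h)
          rw [this] at hj
          exact hj (d_apply_base C _)
        have hr : (μ *ᵥ x₂) C.base = μ C.base D.base * x₂ D.base :=
          Finset.sum_eq_single D.base (fun i _ hi => by rw [hbase₂ i hi, mul_zero]) (by simp)
        rwa [Pi.add_apply, hl, hr, hμb, if_pos rfl, one_mul, zero_add] at h0
      refine ⟨Sum.elim 0 (Pi.single D.base (x₁ C.base)), ?_, ?_⟩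
      · rintro (j | i) h
        · exact absurd rfl h
        · have hi : i = D.base := by
            by_contra hi
            exact h (by simp [hi])
          change D.deg i + m ≤ m + a
          rw [hi, D.deg_base, zero_add]
          exact hmb
      · rw [hd]
        congr 1
        · ext j
          rw [Matrix.mulVec_zero, zero_add, Matrix.mulVec_single]
          change μ j D.base * x₁ C.base = x₁ j
          rw [hμb]
          by_cases hj : j = C.base
          · rw [if_pos hj, one_mul, hj]
          · rw [if_neg hj, zero_mul, hbase₁ j hj]
        · ext i
          rw [Matrix.mulVec_single, Pi.neg_apply]
          change -(D.d i D.base * x₁ C.base) = x₂ i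
          rw [d_apply_base, zero_mul, neg_zero]
          by_cases hi : i = D.base
          · rw [hi, hx₂0]
          · rw [hbase₂ i hi]

/-- The frame version of a splitting: if multiplication by `x ^ m` from `R/(I : x ^ m)` to `R/I` has
a lift whose entries are nonunits, then the mapping cone of minimal frames is minimal. -/
theorem exists_minimal_cone (C : Frame k U₁ κ) (D : Frame k U₂ ι) (hC : C.IsMinimal)
    (hD : D.IsMinimal) (m : V →₀ ℕ) (hm : m ≠ 0) (h₁ : IsUpperSet U₁)
    (hU : ∀ a, a ∈ U₂ ↔ a + m ∈ U₁) (c : (V →₀ ℕ) → (V →₀ ℕ)) (hmono : Monotone c)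
    (hc : ∀ a ∈ U₂, c a ∈ U₁) (hlt : ∀ a ∈ U₂, c a < a + m) :
    ∃ E : Frame k (U₁ ∪ Set.Ici m) (κ ⊕ ι), E.IsMinimal ∧
      E.homDeg = Sum.elim C.homDeg (fun i => D.homDeg i + 1) ∧
      E.deg = Sum.elim C.deg (fun i => D.deg i + m) := by
  obtain ⟨μ, hμd, hμb, hμh, hμ⟩ := exists_lift C D c hmono hc
  have hμlt : ∀ j i, μ j i ≠ 0 → C.deg j < D.deg i + m := by
    intro j i h
    by_cases hi : i = D.base
    · subst hi
      have hj : j = C.base := by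
        by_contra hj
        exact h (by rw [hμb, if_neg hj])
      rw [hj, C.deg_base, D.deg_base, zero_add]
      exact pos_of_ne_zero hm
    · exact (hμ j i h hi).trans_lt (hlt _ (D.deg_mem i hi))
  refine ⟨cone C D m h₁ hU μ hμd hμb hμh fun j i h => (hμlt j i h).le, ?_, rfl, rfl⟩
  rintro (j | i) (j' | i') h
  · exact hC _ _ h
  · exact (hμlt _ _ h).ne
  · exact absurd rfl h
  · exact fun h' => hD _ _ (neg_ne_zero.mp h) (add_right_cancel h')

end Frame

end MonomialSplitting

/-! ### Uniqueness of graded Betti numbers -/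

namespace GradedResolution

open MvPolynomial

variable {V k : Type*} [Field k]

/-- Homogeneous linear maps of degree `0` between graded free modules. -/
def IsGradedMap {r r' : ℕ} (deg : Fin r → ℕ) (deg' : Fin r' → ℕ)
    (f : (Fin r → MvPolynomial V k) →ₗ[MvPolynomial V k] (Fin r' → MvPolynomial V k)) : Prop :=
  ∀ n x, IsHomogeneousVec deg n x → IsHomogeneousVec deg' n (f x)

theorem IsGradedMap.comp {r r' r'' : ℕ} {deg : Fin r → ℕ} {deg' : Fin r' → ℕ}
    {deg'' : Fin r'' → ℕ}
    {g : (Fin r' → MvPolynomial V k) →ₗ[MvPolynomial V k] (Fin r'' → MvPolynomial V k)}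
    {f : (Fin r → MvPolynomial V k) →ₗ[MvPolynomial V k] (Fin r' → MvPolynomial V k)}
    (hg : IsGradedMap deg' deg'' g) (hf : IsGradedMap deg deg' f) :
    IsGradedMap deg deg'' (g ∘ₗ f) :=
  fun n x hx => hg n _ (hf n x hx)

theorem IsGradedMap.vecComponent_apply {r r' : ℕ} {deg : Fin r → ℕ} {deg' : Fin r' → ℕ}
    {f : (Fin r → MvPolynomial V k) →ₗ[MvPolynomial V k] (Fin r' → MvPolynomial V k)}
    (hf : IsGradedMap deg deg' f) (n : ℕ) (x : Fin r → MvPolynomial V k) :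
    vecComponent deg' n (f x) = f (vecComponent deg n x) := by
  obtain ⟨M, hM⟩ := exists_sum_vecComponent deg x
  conv_lhs => rw [hM]
  conv_rhs => rw [hM]
  rw [map_sum, vecComponent_sum, vecComponent_sum, map_sum]
  refine Finset.sum_congr rfl fun m _ => ?_
  have h1 := isHomogeneousVec_vecComponent deg m x
  rw [vecComponent_of_homogeneous deg n m _ h1, vecComponent_of_homogeneous deg' n m _ (hf _ _ h1)]
  split_ifs <;> simp

theorem isHomogeneousVec_single {r : ℕ} (deg : Fin r → ℕ) (a : Fin r) :
    IsHomogeneousVec deg (deg a) (Pi.single a (1 : MvPolynomial V k)) := by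
  classical
  rw [isHomogeneousVec_iff]
  intro b c hc
  by_cases h : b = a
  · subst h
    rw [Pi.single_eq_same, coeff_one] at hc
    have : c = 0 := by
      by_contra h
      exact hc (if_neg (Ne.symm h))
    simp [this]
  · rw [Pi.single_eq_of_ne h] at hc
    simp at hc

theorem apply_eq_sum {r : ℕ} {M : Type*} [AddCommGroup M] [Module (MvPolynomial V k) M]
    (f : (Fin r → MvPolynomial V k) →ₗ[MvPolynomial V k] M) (x : Fin r → MvPolynomial V k) :
    f x = ∑ a, x a • f (Pi.single a 1) := by
  conv_lhs => rw [pi_eq_sum_univ' x, map_sum]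
  simp only [map_smul]

/-- A linear map whose values lie in the image of `d` factors through `d`. -/
theorem exists_lift {r : ℕ} {M N : Type*} [AddCommGroup M] [Module (MvPolynomial V k) M]
    [AddCommGroup N] [Module (MvPolynomial V k) N]
    (T : (Fin r → MvPolynomial V k) →ₗ[MvPolynomial V k] N) (d : M →ₗ[MvPolynomial V k] N)
    (h : ∀ x, ∃ y, d y = T x) :
    ∃ f : (Fin r → MvPolynomial V k) →ₗ[MvPolynomial V k] M, ∀ x, d (f x) = T x := by
  choose y hy using h
  refine ⟨Fintype.linearCombination (MvPolynomial V k) fun a => y (Pi.single a 1), fun x => ?_⟩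
  rw [Fintype.linearCombination_apply, map_sum, apply_eq_sum T x]
  simp only [map_smul, hy]

theorem exists_graded_lift {r r' r'' : ℕ} {deg : Fin r → ℕ} {deg' : Fin r' → ℕ}
    {deg'' : Fin r'' → ℕ}
    {T : (Fin r → MvPolynomial V k) →ₗ[MvPolynomial V k] (Fin r'' → MvPolynomial V k)}
    {d : (Fin r' → MvPolynomial V k) →ₗ[MvPolynomial V k] (Fin r'' → MvPolynomial V k)}
    (hT : IsGradedMap deg deg'' T) (hd : IsGradedMap deg' deg'' d) (h : ∀ x, ∃ y, d y = T x) :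
    ∃ f : (Fin r → MvPolynomial V k) →ₗ[MvPolynomial V k] (Fin r' → MvPolynomial V k),
      IsGradedMap deg deg' f ∧ ∀ x, d (f x) = T x := by
  classical
  choose y hy using h
  refine ⟨Fintype.linearCombination (MvPolynomial V k)
    fun a => vecComponent deg' (deg a) (y (Pi.single a 1)), ?_, fun x => ?_⟩
  · intro n x hx a c hc
    rw [Fintype.linearCombination_apply, Finset.sum_apply] at hc
    obtain ⟨b, -, hb⟩ := Finset.mem_biUnion.mp (MvPolynomial.support_sum hc)
    rw [Pi.smul_apply, smul_eq_mul] at hb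
    obtain ⟨c1, hc1, c2, hc2, rfl⟩ := Finset.mem_add.mp (support_mul _ _ hb)
    have h1 := hx b c1 hc1
    have h2 := isHomogeneousVec_vecComponent deg' (deg b) (y (Pi.single b 1)) a c2 hc2
    rw [map_add]
    omega
  · rw [Fintype.linearCombination_apply, map_sum, apply_eq_sum T x]
    refine Finset.sum_congr rfl fun a _ => ?_
    rw [map_smul, ← hd.vecComponent_apply, hy,
      vecComponent_of_homogeneous _ _ _ _ (hT _ _ (isHomogeneousVec_single deg a)), if_pos rfl]

/-- Linear maps preserve the vectors with entries in the maximal ideal `(x_v | v ∈ V)`. -/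
theorem constantCoeff_apply_eq_zero {r r' : ℕ}
    (f : (Fin r → MvPolynomial V k) →ₗ[MvPolynomial V k] (Fin r' → MvPolynomial V k))
    {x : Fin r → MvPolynomial V k} (hx : ∀ a, constantCoeff (x a) = 0) (b : Fin r') :
    constantCoeff (f x b) = 0 := by
  rw [apply_eq_sum f x, Finset.sum_apply, map_sum]
  refine Finset.sum_eq_zero fun a _ => ?_
  rw [Pi.smul_apply, smul_eq_mul, map_mul, hx, zero_mul]

theorem constantCoeff_eq_zero_of_mem {p : MvPolynomial V k}
    (hp : p ∈ Ideal.span (Set.range (X : V → MvPolynomial V k))) : constantCoeff p = 0 := by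
  have h : Ideal.span (Set.range (X : V → MvPolynomial V k)) ≤
      RingHom.ker (constantCoeff : MvPolynomial V k →+* k) := by
    rw [Ideal.span_le]
    rintro _ ⟨v, rfl⟩
    simp [RingHom.mem_ker]
  exact h hp

namespace MinimalResolution

variable {I : Ideal (MvPolynomial V k)}

theorem isGradedMap_d (ℱ : MinimalResolution I) (i : ℕ) :
    IsGradedMap (ℱ.deg (i + 1)) (ℱ.deg i) (ℱ.d i) := ℱ.d_homogeneous i

theorem exists_d_eq_iff (ℱ : MinimalResolution I) (i : ℕ) (x) :
    (∃ y, ℱ.d (i + 1) y = x) ↔ ℱ.d i x = 0 := by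
  rw [← LinearMap.mem_ker, ← ℱ.exact_succ]
  rfl

theorem exists_d_zero_eq_iff (ℱ : MinimalResolution I) (x) :
    (∃ y, ℱ.d 0 y = x) ↔ ℱ.aug x = 0 := by
  rw [← LinearMap.mem_ker, ← ℱ.exact_zero]
  rfl

theorem d_d (ℱ : MinimalResolution I) (i : ℕ) (x) : ℱ.d i (ℱ.d (i + 1) x) = 0 :=
  (ℱ.exists_d_eq_iff i _).mp ⟨x, rfl⟩

theorem aug_d (ℱ : MinimalResolution I) (x) : ℱ.aug (ℱ.d 0 x) = 0 :=
  (ℱ.exists_d_zero_eq_iff _).mp ⟨x, rfl⟩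

theorem constantCoeff_d (ℱ : MinimalResolution I) (i : ℕ) (x) (a) :
    constantCoeff (ℱ.d i x a) = 0 :=
  constantCoeff_eq_zero_of_mem (ℱ.minimal i x a)

/-- The augmentation with values in a free module of rank one. -/
noncomputable def augVec (ℱ : MinimalResolution I) :
    (Fin (ℱ.rank 0) → MvPolynomial V k) →ₗ[MvPolynomial V k] (Fin 1 → MvPolynomial V k) :=
  LinearMap.pi fun _ => ℱ.aug

theorem isGradedMap_augVec (ℱ : MinimalResolution I) :
    IsGradedMap (ℱ.deg 0) (fun _ => 0) ℱ.augVec := by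
  intro n x hx a c hc
  have := ℱ.aug_homogeneous n x hx (mem_support_iff.mp hc)
  rw [Finsupp.degree_eq_weight_one]
  exact this

theorem exists_comparison_aug (ℱ 𝒢 : MinimalResolution I) :
    ∃ f : (Fin (ℱ.rank 0) → MvPolynomial V k) →ₗ[MvPolynomial V k]
        (Fin (𝒢.rank 0) → MvPolynomial V k),
      IsGradedMap (ℱ.deg 0) (𝒢.deg 0) f ∧ ∀ x, 𝒢.aug (f x) = ℱ.aug x := by
  obtain ⟨f, hf, h⟩ := exists_graded_lift ℱ.isGradedMap_augVec 𝒢.isGradedMap_augVec (fun x => by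
    have : ℱ.aug x ∈ LinearMap.range 𝒢.aug := by
      rw [𝒢.range_aug]
      exact ℱ.range_aug.le ⟨x, rfl⟩
    obtain ⟨y, hy⟩ := this
    exact ⟨y, funext fun _ => hy⟩)
  exact ⟨f, hf, fun x => congrFun (h x) 0⟩

/-- Stage `i` of the comparison of two minimal resolutions: there are homogeneous maps `f`, `g`
in both directions, compatible with the images of the differentials, and a homotopy `s` showing
that `g ∘ f` is the identity modulo the maximal ideal. -/
theorem exists_comparison (ℱ 𝒢 : MinimalResolution I) (i : ℕ) :
    ∃ (f : (Fin (ℱ.rank i) → MvPolynomial V k) →ₗ[MvPolynomial V k]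
          (Fin (𝒢.rank i) → MvPolynomial V k))
      (g : (Fin (𝒢.rank i) → MvPolynomial V k) →ₗ[MvPolynomial V k]
          (Fin (ℱ.rank i) → MvPolynomial V k))
      (s : (Fin (ℱ.rank i) → MvPolynomial V k) →ₗ[MvPolynomial V k]
          (Fin (ℱ.rank (i + 1)) → MvPolynomial V k)),
      IsGradedMap (ℱ.deg i) (𝒢.deg i) f ∧ IsGradedMap (𝒢.deg i) (ℱ.deg i) g ∧
      (∀ x, ∃ y, 𝒢.d i y = f (ℱ.d i x)) ∧ (∀ y, ∃ x, ℱ.d i x = g (𝒢.d i y)) ∧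
      (∀ x, ℱ.d i (s (ℱ.d i x)) = g (f (ℱ.d i x)) - ℱ.d i x) ∧
      (∀ x a, constantCoeff ((g (f x) - x) a) = 0) := by
  induction i with
  | zero =>
    obtain ⟨f, hf, hfa⟩ := exists_comparison_aug ℱ 𝒢
    obtain ⟨g, hg, hga⟩ := exists_comparison_aug 𝒢 ℱ
    obtain ⟨s, hs⟩ := exists_lift (g ∘ₗ f - LinearMap.id) (ℱ.d 0) (fun x => by
      rw [ℱ.exists_d_zero_eq_iff]
      simp [hfa, hga])
    refine ⟨f, g, s, hf, hg, fun x => ?_, fun y => ?_, fun x => by rw [hs]; simp, fun x a => ?_⟩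
    · rw [𝒢.exists_d_zero_eq_iff, hfa, ℱ.aug_d]
    · rw [ℱ.exists_d_zero_eq_iff, hga, 𝒢.aug_d]
    · have : g (f x) - x = ℱ.d 0 (s x) := by rw [hs]; simp
      rw [this]
      exact ℱ.constantCoeff_d 0 _ a
  | succ i ih =>
    obtain ⟨f, g, s, hf, hg, hfd, hgd, hs, -⟩ := ih
    obtain ⟨f', hf', hfd'⟩ := exists_graded_lift (hf.comp (ℱ.isGradedMap_d i))
      (𝒢.isGradedMap_d i) hfd
    obtain ⟨g', hg', hgd'⟩ := exists_graded_lift (hg.comp (𝒢.isGradedMap_d i))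
      (ℱ.isGradedMap_d i) hgd
    simp only [LinearMap.comp_apply] at hfd' hgd'
    obtain ⟨s', hs'⟩ := exists_lift (g' ∘ₗ f' - LinearMap.id - s ∘ₗ ℱ.d i) (ℱ.d (i + 1))
      (fun x => by
        rw [ℱ.exists_d_eq_iff]
        simp [hfd', hgd', hs])
    simp only [LinearMap.sub_apply, LinearMap.comp_apply, LinearMap.id_apply] at hs'
    refine ⟨f', g', s', hf', hg', fun x => ?_, fun y => ?_, fun x => ?_, fun x a => ?_⟩
    · rw [𝒢.exists_d_eq_iff, hfd', ℱ.d_d, map_zero]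
    · rw [ℱ.exists_d_eq_iff, hgd', 𝒢.d_d, map_zero]
    · rw [hs', ℱ.d_d, map_zero, sub_zero]
    · have : g' (f' x) - x = ℱ.d (i + 1) (s' x) + s (ℱ.d i x) := by rw [hs']; abel
      rw [this, Pi.add_apply, map_add, ℱ.constantCoeff_d,
        constantCoeff_apply_eq_zero s (ℱ.constantCoeff_d i x), add_zero]

/-- The constant terms of `f` and `g` restrict to matrices between the basis elements of degree `j`,
with product the identity. -/
theorem betti_le (ℱ 𝒢 : MinimalResolution I) (i j : ℕ) : ℱ.betti i j ≤ 𝒢.betti i j := by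
  classical
  obtain ⟨f, g, -, hf, -, -, -, -, hgf⟩ := exists_comparison ℱ 𝒢 i
  let A : Matrix {a // ℱ.deg i a = j} {b // 𝒢.deg i b = j} k :=
    Matrix.of fun a b => constantCoeff (f (Pi.single a.1 1) b.1)
  let B : Matrix {b // 𝒢.deg i b = j} {a // ℱ.deg i a = j} k :=
    Matrix.of fun b a => constantCoeff (g (Pi.single b.1 1) a.1)
  have hAB : A * B = 1 := by
    ext a a'
    have h1 : constantCoeff (g (f (Pi.single a.1 1)) a'.1) = (1 : Matrix _ _ k) a a' := by
      have := hgf (Pi.single a.1 1) a'.1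
      rw [Pi.sub_apply, map_sub, sub_eq_zero] at this
      rw [this, Matrix.one_apply, Pi.single_apply]
      by_cases h : a = a'
      · simp [h]
      · rw [if_neg h, if_neg fun h' => h (Subtype.ext h'.symm), map_zero]
    -- homogeneity confines the constant terms to basis elements of equal degree
    have h2 : ∀ b, constantCoeff (f (Pi.single a.1 1) b) *
        constantCoeff (g (Pi.single b 1) a'.1) ≠ 0 → 𝒢.deg i b = j := by
      intro b hb
      have h3 := hf _ _ (isHomogeneousVec_single (ℱ.deg i) a.1) b 0
        (mem_support_iff.mpr (left_ne_zero_of_mul hb))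
      rw [map_zero, zero_add] at h3
      rw [h3, a.2]
    rw [← h1, apply_eq_sum g, Finset.sum_apply, map_sum, Matrix.mul_apply]
    simp only [Pi.smul_apply, smul_eq_mul, map_mul]
    rw [← Finset.sum_filter_of_ne (p := fun b => 𝒢.deg i b = j) fun b _ => h2 b]
    exact (Finset.sum_subtype (p := fun b => 𝒢.deg i b = j) _ (by simp) fun b =>
      constantCoeff (f (Pi.single a.1 1) b) * constantCoeff (g (Pi.single b 1) a'.1)).symm
  have hrank := Matrix.rank_mul_le_left A B
  rw [hAB, Matrix.rank_one] at hrank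
  have := hrank.trans (Matrix.rank_le_card_width A)
  rwa [Fintype.card_subtype, Fintype.card_subtype] at this

theorem betti_eq (ℱ 𝒢 : MinimalResolution I) (i j : ℕ) : ℱ.betti i j = 𝒢.betti i j :=
  le_antisymm (betti_le ℱ 𝒢 i j) (betti_le 𝒢 ℱ i j)

end MinimalResolution

/-- The graded Betti numbers can be read off from any minimal graded free resolution. -/
theorem gradedBetti_eq {I : Ideal (MvPolynomial V k)} (ℱ : MinimalResolution I) (i j : ℕ) :
    gradedBetti I i j = ℱ.betti i j := by
  rw [gradedBetti, dif_pos ⟨ℱ⟩]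
  exact MinimalResolution.betti_eq _ _ i j

end GradedResolution

/-! ### The resolution of a frame -/

namespace MonomialSplitting

open Matrix MvPolynomial GradedResolution

namespace Frame

variable {k : Type*} [Field k] {V : Type*} {U : Set (V →₀ ℕ)} {ι : Type}

open Classical in
/-- The component of multidegree `b` of an element of the free module `⨁ R(-deg a)`. -/
noncomputable def strandVec (deg : ι → V →₀ ℕ) (b : V →₀ ℕ) (f : ι → MvPolynomial V k) : ι → k :=
  fun a => if deg a ≤ b then coeff (b - deg a) (f a) else 0

theorem deg_le_of_strandVec_ne_zero {deg : ι → V →₀ ℕ} {b : V →₀ ℕ} {f : ι → MvPolynomial V k}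
    {a : ι} (h : strandVec deg b f a ≠ 0) : deg a ≤ b := by
  by_contra h'
  exact h (if_neg h')

theorem strandVec_add_deg (deg : ι → V →₀ ℕ) (c : V →₀ ℕ) (f : ι → MvPolynomial V k) (a : ι) :
    strandVec deg (c + deg a) f a = coeff c (f a) := by
  rw [strandVec, if_pos (by simp), add_tsub_cancel_right]

theorem ext_strandVec {deg : ι → V →₀ ℕ} {f g : ι → MvPolynomial V k}
    (h : ∀ b, strandVec deg b f = strandVec deg b g) : f = g := by
  ext a c
  rw [← strandVec_add_deg deg, h, strandVec_add_deg]

theorem strandVec_zero (deg : ι → V →₀ ℕ) (b : V →₀ ℕ) :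
    strandVec deg b (0 : ι → MvPolynomial V k) = 0 := by
  ext a
  simp [strandVec]

variable [Fintype ι]

/-- The multigraded differential over the polynomial ring that is encoded by a frame. -/
noncomputable def polyD (C : Frame k U ι) : Matrix ι ι (MvPolynomial V k) :=
  Matrix.of fun i j => monomial (C.deg j - C.deg i) (C.d i j)

theorem polyD_apply (C : Frame k U ι) (i j : ι) :
    C.polyD i j = monomial (C.deg j - C.deg i) (C.d i j) := rfl

theorem d_ne_zero_of_polyD {C : Frame k U ι} {i j : ι} (h : C.polyD i j ≠ 0) : C.d i j ≠ 0 := by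
  intro h'
  rw [polyD_apply, h', monomial_zero] at h
  exact h rfl

/-- In each multidegree, the differential acts through its matrix of scalars. -/
theorem strandVec_polyD (C : Frame k U ι) (b : V →₀ ℕ) (f : ι → MvPolynomial V k) :
    strandVec C.deg b (C.polyD *ᵥ f) = C.d *ᵥ strandVec C.deg b f := by
  classical
  ext a
  by_cases hab : C.deg a ≤ b
  · rw [strandVec, if_pos hab]
    simp only [Matrix.mulVec, dotProduct]
    rw [coeff_sum]
    refine Finset.sum_congr rfl fun j _ => ?_
    rw [polyD_apply, coeff_monomial_mul']
    by_cases hd : C.d a j = 0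
    · simp [hd]
    have haj := C.deg_le_of_ne _ _ hd
    by_cases hjb : C.deg j ≤ b
    · rw [if_pos (tsub_le_tsub_right hjb _), strandVec, if_pos hjb, tsub_tsub_tsub_cancel_right haj]
    · rw [if_neg, strandVec, if_neg hjb, mul_zero]
      intro h
      exact hjb ((tsub_le_iff_right.mp h).trans_eq (tsub_add_cancel_of_le hab))
  · rw [strandVec, if_neg hab]
    by_contra hne
    obtain ⟨j, hj, hfj⟩ := exists_of_mulVec_ne_zero (Ne.symm hne)
    exact hab ((C.deg_le_of_ne _ _ hj).trans (deg_le_of_strandVec_ne_zero hfj))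

theorem polyD_mulVec_polyD_mulVec (C : Frame k U ι) (f : ι → MvPolynomial V k) :
    C.polyD *ᵥ (C.polyD *ᵥ f) = 0 := by
  refine ext_strandVec (deg := C.deg) fun b => ?_
  rw [strandVec_polyD, strandVec_polyD, C.d_mulVec_d_mulVec, strandVec_zero]

/-- The complex of a frame is exact at the elements whose coefficient in homological degree `0` lies
in the monomial ideal. -/
theorem exact_polyD (C : Frame k U ι) (hU : IsUpperSet U) (f : ι → MvPolynomial V k)
    (hf : C.polyD *ᵥ f = 0) (hbase : ∀ c ∈ (f C.base).support, c ∈ U) :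
    ∃ g, C.polyD *ᵥ g = f := by
  classical
  have hstrand : ∀ b, ∃ y : ι → k, (∀ i, y i ≠ 0 → C.deg i ≤ b) ∧
      C.d *ᵥ y = strandVec C.deg b f := by
    intro b
    by_cases hb : b ∈ U
    · exact C.exact b hb _ (fun i => deg_le_of_strandVec_ne_zero)
        (by rw [← strandVec_polyD, hf, strandVec_zero])
    · refine ⟨0, fun i hi => absurd rfl hi, ?_⟩
      rw [Matrix.mulVec_zero]
      ext a
      by_contra hne
      have hab := deg_le_of_strandVec_ne_zero (Ne.symm hne)
      by_cases ha : a = C.base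
      · subst ha
        rw [strandVec, if_pos hab, C.deg_base, tsub_zero] at hne
        exact hb (hbase b (mem_support_iff.mpr (Ne.symm hne)))
      · exact hb (hU hab (C.deg_mem a ha))
  choose y hy hdy using hstrand
  -- only finitely many multidegrees occur in `f`
  let B : Finset (V →₀ ℕ) := Finset.univ.biUnion fun a => (f a).support.image (· + C.deg a)
  have hB : ∀ b, b ∉ B → strandVec C.deg b f = 0 := by
    intro b hb
    ext a
    by_contra hne
    have hab := deg_le_of_strandVec_ne_zero hne
    rw [strandVec, if_pos hab] at hne
    refine hb (Finset.mem_biUnion.mpr ⟨a, Finset.mem_univ a, Finset.mem_image.mpr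
      ⟨b - C.deg a, mem_support_iff.mpr hne, tsub_add_cancel_of_le hab⟩⟩)
  let g : ι → MvPolynomial V k := fun a => ∑ b ∈ B, monomial (b - C.deg a) (y b a)
  have hg : ∀ b, strandVec C.deg b g = if b ∈ B then y b else 0 := by
    intro b
    ext a
    by_cases hab : C.deg a ≤ b
    · rw [strandVec, if_pos hab, coeff_sum]
      have : ∀ b' ∈ B, coeff (b - C.deg a) (monomial (b' - C.deg a) (y b' a)) =
          if b' = b then y b a else 0 := by
        intro b' _
        rw [coeff_monomial]
        by_cases hbb : b' = b
        · simp [hbb]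
        · rw [if_neg hbb]
          by_cases hya : y b' a = 0
          · simp [hya]
          · rw [if_neg]
            intro h
            apply hbb
            rw [← tsub_add_cancel_of_le (hy b' a hya), h, tsub_add_cancel_of_le hab]
      rw [Finset.sum_congr rfl this, Finset.sum_ite_eq']
      split_ifs <;> rfl
    · rw [strandVec, if_neg hab]
      split_ifs
      · by_contra h
        exact hab (hy b a (Ne.symm h))
      · rfl
  refine ⟨g, ext_strandVec (deg := C.deg) fun b => ?_⟩
  rw [strandVec_polyD, hg]
  split_ifs with hb
  · exact hdy b
  · rw [hB b hb, Matrix.mulVec_zero]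

/-- The basis elements of homological degree `n`. -/
abbrev Level (C : Frame k U ι) (n : ℕ) : Type := {a : ι // C.homDeg a = n}

/-- Extension by zero from homological degree `n`, with the basis numbered by `Fin`. -/
noncomputable def extend (C : Frame k U ι) (n : ℕ) :
    (Fin (Fintype.card (C.Level n)) → MvPolynomial V k) →ₗ[MvPolynomial V k]
      (ι → MvPolynomial V k) where
  toFun f a := if h : C.homDeg a = n then f (Fintype.equivFin (C.Level n) ⟨a, h⟩) else 0
  map_add' f g := by
    ext1 a
    by_cases h : C.homDeg a = n <;> simp [h]
  map_smul' c f := by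
    ext1 a
    by_cases h : C.homDeg a = n <;> simp [h]

/-- Restriction to homological degree `n`. -/
noncomputable def restrict (C : Frame k U ι) (n : ℕ) :
    (ι → MvPolynomial V k) →ₗ[MvPolynomial V k]
      (Fin (Fintype.card (C.Level n)) → MvPolynomial V k) :=
  LinearMap.funLeft _ _ fun b => ((Fintype.equivFin (C.Level n)).symm b).1

theorem restrict_apply (C : Frame k U ι) (n : ℕ) (f : ι → MvPolynomial V k)
    (b : Fin (Fintype.card (C.Level n))) :
    C.restrict n f b = f ((Fintype.equivFin (C.Level n)).symm b).1 := rfl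

theorem extend_apply_of_ne (C : Frame k U ι) {n : ℕ}
    (f : Fin (Fintype.card (C.Level n)) → MvPolynomial V k) {a : ι} (h : C.homDeg a ≠ n) :
    C.extend n f a = 0 := dif_neg h

theorem extend_apply_symm (C : Frame k U ι) (n : ℕ)
    (f : Fin (Fintype.card (C.Level n)) → MvPolynomial V k) (b : Fin (Fintype.card (C.Level n))) :
    C.extend n f ((Fintype.equivFin (C.Level n)).symm b).1 = f b := by
  change dite _ _ _ = _
  rw [dif_pos ((Fintype.equivFin (C.Level n)).symm b).2]
  simp

theorem extend_restrict_apply (C : Frame k U ι) {n : ℕ} (f : ι → MvPolynomial V k) {a : ι}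
    (h : C.homDeg a = n) : C.extend n (C.restrict n f) a = f a := by
  change dite _ _ _ = _
  rw [dif_pos h, restrict_apply, Equiv.symm_apply_apply]

theorem polyD_mulVec_extend_apply_of_ne (C : Frame k U ι) {n : ℕ}
    (f : Fin (Fintype.card (C.Level (n + 1))) → MvPolynomial V k) {a : ι} (h : C.homDeg a ≠ n) :
    (C.polyD *ᵥ C.extend (n + 1) f) a = 0 := by
  by_contra hne
  obtain ⟨j, -, hj⟩ := Finset.exists_ne_zero_of_sum_ne_zero hne
  have h1 := C.homDeg_of_ne _ _ (d_ne_zero_of_polyD (left_ne_zero_of_mul hj))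
  have h2 : C.homDeg j = n + 1 := by
    by_contra h2
    exact right_ne_zero_of_mul hj (C.extend_apply_of_ne f h2)
  omega

theorem polyD_mulVec_extend_restrict (C : Frame k U ι) {n : ℕ} (g : ι → MvPolynomial V k) {a : ι}
    (h : C.homDeg a = n) :
    (C.polyD *ᵥ C.extend (n + 1) (C.restrict (n + 1) g)) a = (C.polyD *ᵥ g) a := by
  simp only [Matrix.mulVec, dotProduct]
  refine Finset.sum_congr rfl fun j _ => ?_
  by_cases hj : C.polyD a j = 0
  · simp [hj]
  · rw [extend_restrict_apply]
    rw [← C.homDeg_of_ne _ _ (d_ne_zero_of_polyD hj), h]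

/-- The differential from homological degree `n + 1` to homological degree `n`. -/
noncomputable def levelD (C : Frame k U ι) (n : ℕ) :
    (Fin (Fintype.card (C.Level (n + 1))) → MvPolynomial V k) →ₗ[MvPolynomial V k]
      (Fin (Fintype.card (C.Level n)) → MvPolynomial V k) :=
  C.restrict n ∘ₗ C.polyD.mulVecLin ∘ₗ C.extend (n + 1)

theorem levelD_apply (C : Frame k U ι) (n : ℕ) (f) :
    C.levelD n f = C.restrict n (C.polyD *ᵥ C.extend (n + 1) f) := rfl

theorem extend_levelD (C : Frame k U ι) (n : ℕ) (f) :
    C.extend n (C.levelD n f) = C.polyD *ᵥ C.extend (n + 1) f := by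
  ext1 a
  by_cases h : C.homDeg a = n
  · rw [levelD_apply, extend_restrict_apply _ _ h]
  · rw [extend_apply_of_ne _ _ h, polyD_mulVec_extend_apply_of_ne _ _ h]

theorem polyD_mulVec_extend_eq_zero_iff (C : Frame k U ι) (hU : IsUpperSet U) (n : ℕ)
    (f : Fin (Fintype.card (C.Level (n + 1))) → MvPolynomial V k) :
    C.polyD *ᵥ C.extend (n + 1) f = 0 ↔ ∃ g, C.levelD (n + 1) g = f := by
  constructor
  · intro h
    have hb : C.extend (n + 1) f C.base = 0 :=
      C.extend_apply_of_ne f (by rw [(C.homDeg_eq_zero_iff _).mpr rfl]; omega)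
    obtain ⟨g, hg⟩ := C.exact_polyD hU _ h (by simp [hb])
    refine ⟨C.restrict (n + 2) g, ?_⟩
    ext1 b
    rw [levelD_apply, restrict_apply, polyD_mulVec_extend_restrict _ _
      ((Fintype.equivFin (C.Level (n + 1))).symm b).2, hg, extend_apply_symm]
  · rintro ⟨g, rfl⟩
    rw [extend_levelD, polyD_mulVec_polyD_mulVec]

theorem levelD_eq_zero_iff (C : Frame k U ι) (n : ℕ) (f) :
    C.levelD n f = 0 ↔ C.polyD *ᵥ C.extend (n + 1) f = 0 := by
  constructor
  · intro h
    rw [← extend_levelD, h, map_zero]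
  · intro h
    rw [levelD_apply, h, map_zero]

/-- The augmentation onto the monomial ideal. -/
noncomputable def aug (C : Frame k U ι) :
    (Fin (Fintype.card (C.Level 1)) → MvPolynomial V k) →ₗ[MvPolynomial V k] MvPolynomial V k :=
  LinearMap.proj C.base ∘ₗ C.polyD.mulVecLin ∘ₗ C.extend 1

theorem aug_apply (C : Frame k U ι) (f) : C.aug f = (C.polyD *ᵥ C.extend 1 f) C.base := rfl

theorem aug_eq_zero_iff (C : Frame k U ι) (f) :
    C.aug f = 0 ↔ C.polyD *ᵥ C.extend 1 f = 0 := by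
  constructor
  · intro h
    ext1 a
    by_cases ha : a = C.base
    · rw [ha, ← aug_apply, h]
      rfl
    · exact C.polyD_mulVec_extend_apply_of_ne f (n := 0)
        fun h => ha ((C.homDeg_eq_zero_iff a).mp h)
  · intro h
    rw [aug_apply, h]
    rfl

theorem mem_support_polyD_mulVec (C : Frame k U ι) (f : ι → MvPolynomial V k) (a : ι)
    (c : V →₀ ℕ) (hc : c ∈ ((C.polyD *ᵥ f) a).support) :
    ∃ j, C.d a j ≠ 0 ∧ ∃ c' ∈ (f j).support, c + C.deg a = c' + C.deg j := by
  classical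
  obtain ⟨j, -, hj⟩ := Finset.mem_biUnion.mp (MvPolynomial.support_sum hc)
  obtain ⟨c1, hc1, c2, hc2, rfl⟩ := Finset.mem_add.mp (support_mul _ _ hj)
  change c1 ∈ (monomial (C.deg j - C.deg a) (C.d a j)).support at hc1
  have hd : C.d a j ≠ 0 := by
    intro h
    rw [h, monomial_zero] at hc1
    simp at hc1
  rw [support_monomial, if_neg hd, Finset.mem_singleton] at hc1
  refine ⟨j, hd, c2, hc2, ?_⟩
  rw [hc1, add_right_comm, tsub_add_cancel_of_le (C.deg_le_of_ne _ _ hd), add_comm]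

/-- The standard degrees of the basis elements of homological degree `n`. -/
noncomputable def levelDeg (C : Frame k U ι) (n : ℕ) (b : Fin (Fintype.card (C.Level n))) : ℕ :=
  (C.deg ((Fintype.equivFin (C.Level n)).symm b).1).degree

theorem degree_of_mem_support_polyD_mulVec (C : Frame k U ι) {n m : ℕ}
    {f : Fin (Fintype.card (C.Level (n + 1))) → MvPolynomial V k}
    (hf : IsHomogeneousVec (C.levelDeg (n + 1)) m f) (a : ι) (c : V →₀ ℕ)
    (hc : c ∈ ((C.polyD *ᵥ C.extend (n + 1) f) a).support) :
    c.degree + (C.deg a).degree = m := by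
  obtain ⟨j, -, c', hc', h⟩ := C.mem_support_polyD_mulVec _ a c hc
  by_cases hj : C.homDeg j = n + 1
  · have h1 := hf (Fintype.equivFin (C.Level (n + 1)) ⟨j, hj⟩) c' (by
      rwa [show C.extend (n + 1) f j = _ from dif_pos hj] at hc')
    rw [levelDeg, Equiv.symm_apply_apply] at h1
    rw [← h1, ← map_add, h, map_add]
  · rw [C.extend_apply_of_ne f hj] at hc'
    simp at hc'

theorem monomial_mem_span_X {e : V →₀ ℕ} (he : e ≠ 0) (c : k) :
    monomial e c ∈ Ideal.span (Set.range (X : V → MvPolynomial V k)) := by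
  rw [← Set.image_univ, mem_ideal_span_X_image]
  intro m hm
  obtain rfl := Finset.mem_singleton.mp (support_monomial_subset hm)
  obtain ⟨v, hv⟩ := Finsupp.ne_iff.mp he
  exact ⟨v, Set.mem_univ v, hv⟩

/-- The minimal graded free resolution given by a minimal frame of a monomial ideal. -/
noncomputable def toMinimalResolution (C : Frame k U ι) (hC : C.IsMinimal) (hU : IsUpperSet U)
    (I : Ideal (MvPolynomial V k)) (hI : ∀ p, p ∈ I ↔ ∀ c ∈ p.support, c ∈ U) :
    MinimalResolution I where
  rank i := Fintype.card (C.Level (i + 1))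
  deg i := C.levelDeg (i + 1)
  d i := C.levelD (i + 1)
  aug := C.aug
  d_homogeneous i n f hf b c hc := C.degree_of_mem_support_polyD_mulVec hf _ c hc
  aug_homogeneous n f hf c hc := by
    have := C.degree_of_mem_support_polyD_mulVec hf C.base c (mem_support_iff.mpr hc)
    rw [C.deg_base, map_zero, add_zero, Finsupp.degree_eq_weight_one] at this
    exact this
  range_aug := by
    ext p
    rw [LinearMap.mem_range, hI]
    constructor
    · rintro ⟨f, rfl⟩ c hc
      obtain ⟨j, hj, c', -, h⟩ := C.mem_support_polyD_mulVec _ _ c hc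
      rw [C.deg_base, add_zero] at h
      rw [h]
      refine hU le_add_self (C.deg_mem j fun h => ?_)
      rw [h, C.d_apply_base] at hj
      exact hj rfl
    · intro hp
      classical
      have h0 : C.polyD *ᵥ Pi.single C.base p = 0 := by
        ext1 a
        rw [Matrix.mulVec_single]
        change C.polyD a C.base * p = 0
        rw [polyD_apply, C.d_apply_base, monomial_zero, zero_mul]
      obtain ⟨g, hg⟩ := C.exact_polyD hU _ h0 (by simpa using hp)
      refine ⟨C.restrict 1 g, ?_⟩
      rw [aug_apply, polyD_mulVec_extend_restrict C g ((C.homDeg_eq_zero_iff _).mpr rfl), hg,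
        Pi.single_eq_same]
  exact_zero := by
    ext f
    rw [LinearMap.mem_range, LinearMap.mem_ker, aug_eq_zero_iff,
      C.polyD_mulVec_extend_eq_zero_iff hU 0]
  exact_succ i := by
    ext f
    rw [LinearMap.mem_range, LinearMap.mem_ker, levelD_eq_zero_iff,
      C.polyD_mulVec_extend_eq_zero_iff hU]
  minimal i f b := by
    rw [levelD_apply, restrict_apply]
    refine Ideal.sum_mem _ fun j _ => Ideal.mul_mem_right _ _ ?_
    change monomial _ (C.d _ j) ∈ _
    by_cases hd : C.d ((Fintype.equivFin (C.Level (i + 1))).symm b).1 j = 0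
    · rw [hd, monomial_zero]
      exact Ideal.zero_mem _
    · refine monomial_mem_span_X (fun h => hC _ _ hd ?_) _
      exact le_antisymm (C.deg_le_of_ne _ _ hd) (tsub_eq_zero_iff_le.mp h)

/-- The number of basis elements of a frame of homological degree `n` and standard degree `j`. -/
noncomputable def count (C : Frame k U ι) (n j : ℕ) : ℕ :=
  (Finset.univ.filter fun a => C.homDeg a = n ∧ (C.deg a).degree = j).card

theorem count_zero (C : Frame k U ι) (j : ℕ) : C.count 0 j = if j = 0 then 1 else 0 := by
  classical
  have : (Finset.univ.filter fun a => C.homDeg a = 0 ∧ (C.deg a).degree = j) =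
      if j = 0 then {C.base} else ∅ := by
    ext a
    rw [Finset.mem_filter, C.homDeg_eq_zero_iff]
    split_ifs with hj
    · simp only [Finset.mem_univ, true_and, Finset.mem_singleton, and_iff_left_iff_imp]
      rintro rfl
      rw [C.deg_base, hj, map_zero]
    · simp only [Finset.mem_univ, true_and, Finset.notMem_empty, iff_false, not_and]
      rintro rfl h
      rw [C.deg_base, map_zero] at h
      exact hj h.symm
  rw [count, this]
  split_ifs <;> rfl

theorem gradedBetti_eq_count (C : Frame k U ι) (hC : C.IsMinimal) (hU : IsUpperSet U)
    (I : Ideal (MvPolynomial V k)) (hI : ∀ p, p ∈ I ↔ ∀ c ∈ p.support, c ∈ U) (i j : ℕ) :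
    gradedBetti I i j = C.count (i + 1) j := by
  rw [gradedBetti_eq (C.toMinimalResolution hC hU I hI)]
  refine Finset.card_bij (fun b _ => ((Fintype.equivFin (C.Level (i + 1))).symm b).1) ?_ ?_ ?_
  · intro b hb
    exact Finset.mem_filter.mpr ⟨Finset.mem_univ _,
      ((Fintype.equivFin (C.Level (i + 1))).symm b).2, (Finset.mem_filter.mp hb).2⟩
  · intro b _ b' _ h
    exact (Fintype.equivFin (C.Level (i + 1))).symm.injective (Subtype.ext h)
  · intro a ha
    obtain ⟨-, h1, h2⟩ := Finset.mem_filter.mp ha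
    refine ⟨Fintype.equivFin (C.Level (i + 1)) ⟨a, h1⟩, Finset.mem_filter.mpr
      ⟨Finset.mem_univ _, ?_⟩, ?_⟩
    · change C.levelDeg (i + 1) _ = j
      rw [levelDeg, Equiv.symm_apply_apply, h2]
    · rw [Equiv.symm_apply_apply]

theorem extBetti_eq_count (C : Frame k U ι) (hC : C.IsMinimal) (hU : IsUpperSet U)
    (I : Ideal (MvPolynomial V k)) (hI : ∀ p, p ∈ I ↔ ∀ c ∈ p.support, c ∈ U) (n j : ℕ) :
    extBetti I ((n : ℤ) - 1) j = C.count n j := by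
  cases n with
  | zero =>
    rw [C.count_zero]
    change (if 0 = 0 ∧ j = 0 then 1 else 0) = _
    simp
  | succ n =>
    rw [← C.gradedBetti_eq_count hC hU I hI]
    have : ((n + 1 : ℕ) : ℤ) - 1 = Int.ofNat n := by simp
    rw [this]
    rfl

end Frame

end MonomialSplitting

/-! ### Facets -/

namespace PreAbstractSimplicialComplex

variable {V : Type*}

theorem IsFacet.nonempty {Δ : PreAbstractSimplicialComplex V} {F : Finset V} (hF : Δ.IsFacet F) :
    F.Nonempty :=
  (Δ.isRelLowerSet_faces hF.prop).1

theorem IsFacet.eq_of_subset {Δ : PreAbstractSimplicialComplex V} {F G : Finset V}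
    (hF : Δ.IsFacet F) (hG : Δ.IsFacet G) (h : F ⊆ G) : F = G :=
  hF.eq_of_le hG.prop h

/-- The facets of the complex generated by an antichain of nonempty sets. -/
theorem isFacet_generate_iff {S : Set (Finset V)} (hne : ∀ G ∈ S, G.Nonempty)
    (hanti : ∀ G ∈ S, ∀ H ∈ S, G ⊆ H → G = H) {G : Finset V} :
    (generate S).IsFacet G ↔ G ∈ S := by
  constructor
  · intro hG
    obtain ⟨-, F, hF, hGF⟩ := hG.prop
    have hFS : F ∈ (generate S).faces := ⟨hne F hF, F, hF, subset_rfl⟩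
    rw [hG.eq_of_le hFS hGF]
    exact hF
  · intro hG
    refine ⟨⟨hne G hG, G, hG, subset_rfl⟩, ?_⟩
    rintro H ⟨-, F, hF, hHF⟩ hGH
    rwa [hanti G hG F hF (subset_trans hGH hHF)]

theorem isFacet_generate_iff_of_isFacet {Δ : PreAbstractSimplicialComplex V}
    {S : Set (Finset V)} (hS : ∀ G ∈ S, Δ.IsFacet G) {G : Finset V} :
    (generate S).IsFacet G ↔ G ∈ S :=
  isFacet_generate_iff (fun G hG => (hS G hG).nonempty)
    fun G hG H hH h => (hS G hG).eq_of_subset (hS H hH) h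

theorem isFacet_removeFacet_iff {Δ : PreAbstractSimplicialComplex V} {F G : Finset V} :
    (Δ.removeFacet F).IsFacet G ↔ Δ.IsFacet G ∧ G ≠ F :=
  isFacet_generate_iff_of_isFacet fun _ h => h.1

variable [DecidableEq V]

theorem isFacet_conn_iff {Δ : PreAbstractSimplicialComplex V} {F G : Finset V} :
    (Δ.conn F).IsFacet G ↔ Δ.IsFacet G ∧ Δ.FacetsConnected F G :=
  isFacet_generate_iff_of_isFacet fun _ h => h.1

theorem isFacet_removeSubcomplex_conn_iff {Δ : PreAbstractSimplicialComplex V} {F G : Finset V} :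
    (Δ.removeSubcomplex (Δ.conn F)).IsFacet G ↔ Δ.IsFacet G ∧ ¬ Δ.FacetsConnected F G := by
  refine (isFacet_generate_iff_of_isFacet fun _ h => h.1).trans ?_
  change Δ.IsFacet G ∧ ¬ (Δ.conn F).IsFacet G ↔ _
  rw [isFacet_conn_iff]
  tauto

theorem isFacet_reducedConn_iff {Δ : PreAbstractSimplicialComplex V} {F H : Finset V}
    (hF : Δ.IsFacet F) : (Δ.reducedConn F).IsFacet H ↔
      Minimal (fun H' => ∃ G, (Δ.IsFacet G ∧ Δ.FacetsConnected F G ∧ G ≠ F) ∧ H' = G \ F) H := by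
  have h : ∀ G, ((Δ.conn F).removeFacet F).IsFacet G ↔
      Δ.IsFacet G ∧ Δ.FacetsConnected F G ∧ G ≠ F := by
    intro G
    rw [isFacet_removeFacet_iff, isFacet_conn_iff, and_assoc]
  rw [reducedConn]
  simp only [h]
  refine isFacet_generate_iff ?_ ?_
  · intro H hH
    rw [Set.mem_ofPred_eq] at hH
    obtain ⟨G, ⟨hG, -, hne⟩, rfl⟩ := hH.prop
    rw [Finset.sdiff_nonempty]
    exact fun h => hne (hG.eq_of_subset hF h)
  · intro G hG H hH hGH
    rw [Set.mem_ofPred_eq] at hG hH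
    exact hH.eq_of_le hG.prop hGH

/-- Facets outside the connected component of `F` are disjoint from those inside. -/
theorem FacetsConnected.disjoint {Δ : PreAbstractSimplicialComplex V} {F G H : Finset V}
    (hG : Δ.IsFacet G) (hH : Δ.IsFacet H) (hFG : Δ.FacetsConnected F G)
    (hFH : ¬ Δ.FacetsConnected F H) : Disjoint G H := by
  rw [Finset.disjoint_iff_inter_eq_empty, ← Finset.not_nonempty_iff_eq_empty]
  exact fun h => hFH (hFG.tail ⟨hG, hH, h⟩)

end PreAbstractSimplicialComplex

/-! ### Exponents of facet ideals -/

namespace MonomialSplitting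

open MvPolynomial GradedResolution PreAbstractSimplicialComplex

variable {V : Type*} {k : Type*} [Field k]

/-- The exponent vector of the square-free monomial `x^F`. -/
noncomputable def faceExponent (F : Finset V) : V →₀ ℕ := ∑ v ∈ F, Finsupp.single v 1

theorem faceExponent_apply [DecidableEq V] (F : Finset V) (v : V) :
    faceExponent F v = if v ∈ F then 1 else 0 := by
  rw [faceExponent, Finsupp.finsetSum_apply]
  simp [Finsupp.single_apply]

theorem faceExponent_apply_ne_zero_iff {F : Finset V} {v : V} : faceExponent F v ≠ 0 ↔ v ∈ F := by
  classical
  simp [faceExponent_apply]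

theorem degree_faceExponent (F : Finset V) : (faceExponent F).degree = F.card := by
  simp [faceExponent, map_sum]

theorem faceExponent_ne_zero {F : Finset V} (hF : F.Nonempty) : faceExponent F ≠ 0 := by
  intro h
  have := degree_faceExponent F
  rw [h, map_zero] at this
  exact hF.card_pos.ne this

theorem faceExponent_le_iff {F : Finset V} {a : V →₀ ℕ} :
    faceExponent F ≤ a ↔ ∀ v ∈ F, 1 ≤ a v := by
  classical
  rw [Finsupp.le_def]
  refine forall_congr' fun v => ?_
  rw [faceExponent_apply]
  split_ifs with h <;> simp [h]

theorem faceExponent_le_add_iff [DecidableEq V] {F G : Finset V} {a : V →₀ ℕ} :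
    faceExponent G ≤ a + faceExponent F ↔ faceExponent (G \ F) ≤ a := by
  rw [faceExponent_le_iff, faceExponent_le_iff]
  refine forall_congr' fun v => ?_
  rw [Finsupp.add_apply, faceExponent_apply, Finset.mem_sdiff]
  by_cases h : v ∈ F <;> simp [h]

theorem faceExponent_mono {F G : Finset V} (h : F ⊆ G) : faceExponent F ≤ faceExponent G := by
  classical
  rw [faceExponent_le_iff]
  intro v hv
  rw [faceExponent_apply, if_pos (h hv)]

theorem faceMonomial_eq (F : Finset V) : faceMonomial k F = monomial (faceExponent F) 1 := by
  rw [faceMonomial, faceExponent, monomial_sum_one]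
  rfl

/-- The exponents of the monomials in the facet ideal of `Δ`. -/
def facetUpset (Δ : PreAbstractSimplicialComplex V) : Set (V →₀ ℕ) :=
  Frame.upset (faceExponent '' {G | Δ.IsFacet G})

theorem mem_facetUpset {Δ : PreAbstractSimplicialComplex V} {b : V →₀ ℕ} :
    b ∈ facetUpset Δ ↔ ∃ G, Δ.IsFacet G ∧ faceExponent G ≤ b := by
  simp [facetUpset, Frame.upset]

theorem isUpperSet_facetUpset (Δ : PreAbstractSimplicialComplex V) : IsUpperSet (facetUpset Δ) :=
  Frame.isUpperSet_upset _

theorem mem_facetIdeal_iff (Δ : PreAbstractSimplicialComplex V) (p : MvPolynomial V k) :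
    p ∈ facetIdeal k Δ ↔ ∀ c ∈ p.support, c ∈ facetUpset Δ := by
  have : {p | ∃ F, Δ.IsFacet F ∧ p = faceMonomial k F} =
      (fun s => monomial s (1 : k)) '' (faceExponent '' {G | Δ.IsFacet G}) := by
    ext p
    simp [faceMonomial_eq, eq_comm]
  rw [facetIdeal, this, mem_ideal_span_monomial_image]
  rfl

theorem monomial_mem_facetIdeal_iff (Δ : PreAbstractSimplicialComplex V) (b : V →₀ ℕ) :
    monomial b (1 : k) ∈ facetIdeal k Δ ↔ b ∈ facetUpset Δ := by
  classical
  rw [mem_facetIdeal_iff, support_monomial, if_neg one_ne_zero]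
  simp

theorem monomial_mem_span_faceMonomial_iff (F : Finset V) (b : V →₀ ℕ) :
    monomial b (1 : k) ∈ Ideal.span {faceMonomial k F} ↔ faceExponent F ≤ b := by
  classical
  have : ({faceMonomial k F} : Set (MvPolynomial V k)) =
      (fun s => monomial s (1 : k)) '' {faceExponent F} := by
    rw [Set.image_singleton, faceMonomial_eq]
  rw [this, mem_ideal_span_monomial_image, support_monomial, if_neg one_ne_zero]
  simp

theorem exists_facet_frame (k : Type*) [Field k] [Finite V] (Δ : PreAbstractSimplicialComplex V) :
    ∃ (ι : Type) (_ : Fintype ι) (C : Frame k (facetUpset Δ) ι), C.IsMinimal ∧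
      ∀ i v, C.deg i v ≠ 0 → ∃ G, Δ.IsFacet G ∧ v ∈ G := by
  have hfin : (faceExponent '' {G | Δ.IsFacet G}).Finite := (Set.toFinite _).image _
  have h := Frame.exists_minimal_frame k hfin.toFinset (by
    rw [Set.Finite.mem_toFinset]
    rintro ⟨G, hG, h⟩
    exact faceExponent_ne_zero (IsFacet.nonempty hG) h)
  rw [Set.Finite.coe_toFinset] at h
  obtain ⟨ι, _, C, hC, hdeg⟩ := h
  refine ⟨ι, _, C, hC, fun i v hv => ?_⟩
  obtain ⟨m, hm, hmv⟩ := hdeg i v hv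
  obtain ⟨G, hG, rfl⟩ := hfin.mem_toFinset.mp hm
  exact ⟨G, hG, faceExponent_apply_ne_zero_iff.mp hmv⟩

theorem facetUpset_eq_union {Δ : PreAbstractSimplicialComplex V} {F : Finset V}
    (hF : Δ.IsFacet F) :
    facetUpset Δ = facetUpset (Δ.removeFacet F) ∪ Set.Ici (faceExponent F) := by
  ext b
  rw [Set.mem_union, mem_facetUpset, mem_facetUpset, Set.mem_Ici]
  simp only [isFacet_removeFacet_iff]
  constructor
  · rintro ⟨G, hG, hGb⟩
    by_cases h : G = F
    · exact Or.inr (h ▸ hGb)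
    · exact Or.inl ⟨G, ⟨hG, h⟩, hGb⟩
  · rintro (⟨G, ⟨hG, -⟩, hGb⟩ | h)
    · exact ⟨G, hG, hGb⟩
    · exact ⟨F, hF, h⟩

/-- The colon ideal `𝓘(Δ \ F) : x^F` is the sum of the facet ideals of the reduced connected
component of `F` and of the complement of the connected component of `F`. -/
theorem mem_facetUpset_reducedConn_union_iff [Finite V] [DecidableEq V]
    {Δ : PreAbstractSimplicialComplex V} {F : Finset V} (hF : Δ.IsFacet F) (a : V →₀ ℕ) :
    a ∈ facetUpset (Δ.reducedConn F) ∪ facetUpset (Δ.removeSubcomplex (Δ.conn F)) ↔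
      a + faceExponent F ∈ facetUpset (Δ.removeFacet F) := by
  rw [Set.mem_union, mem_facetUpset, mem_facetUpset, mem_facetUpset]
  simp only [isFacet_removeFacet_iff, isFacet_reducedConn_iff hF,
    isFacet_removeSubcomplex_conn_iff, faceExponent_le_add_iff]
  constructor
  · rintro (⟨H, hH, hHa⟩ | ⟨G, ⟨hG, hFG⟩, hGa⟩)
    · obtain ⟨G, ⟨hG, -, hne⟩, rfl⟩ := hH.prop
      exact ⟨G, ⟨hG, hne⟩, hHa⟩
    · refine ⟨G, ⟨hG, ?_⟩, (faceExponent_mono Finset.sdiff_subset).trans hGa⟩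
      rintro rfl
      exact hFG Relation.ReflTransGen.refl
  · rintro ⟨G, ⟨hG, hne⟩, hGa⟩
    by_cases hFG : Δ.FacetsConnected F G
    · obtain ⟨H, hHG, hH⟩ := exists_minimal_le_of_wellFoundedLT
        (fun H' => ∃ G, (Δ.IsFacet G ∧ Δ.FacetsConnected F G ∧ G ≠ F) ∧ H' = G \ F) (G \ F)
        ⟨G, ⟨hG, hFG, hne⟩, rfl⟩
      exact Or.inl ⟨H, hH, (faceExponent_mono hHG).trans hGa⟩
    · refine Or.inr ⟨G, ⟨hG, hFG⟩, ?_⟩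
      have := FacetsConnected.disjoint hF hG Relation.ReflTransGen.refl hFG
      rwa [Finset.sdiff_eq_self_of_disjoint this.symm] at hGa

/-- The function `ψ` of a splitting provides the degree bounds for a comparison map with nonunit
entries: `c a` is the least common multiple of the `ψ w`, where `w` runs through the minimal
generators of `J ∩ K` dividing `x ^ (a + F)`. -/
theorem exists_degree_bound [Finite V] {Δ : PreAbstractSimplicialComplex V} {F : Finset V}
    (hF : IsSplittingFacet k Δ F) :
    ∃ c : (V →₀ ℕ) → (V →₀ ℕ), Monotone c ∧
      ∀ a, a + faceExponent F ∈ facetUpset (Δ.removeFacet F) →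
        c a ∈ facetUpset (Δ.removeFacet F) ∧ c a < a + faceExponent F := by
  classical
  obtain ⟨φ, ψ, hgen, -, hlt⟩ := hF.2.exists_splittingFunction
  set M := minGens (Ideal.span {faceMonomial k F} ⊓ facetIdeal k (Δ.removeFacet F)) with hM
  let S : (V →₀ ℕ) → Finset (V →₀ ℕ) := fun a =>
    (Finset.Icc 0 (a + faceExponent F)).filter (· ∈ M)
  refine ⟨fun a => (S a).sup ψ, fun a b hab => ?_, fun a ha => ?_⟩
  · refine Finset.sup_mono (Finset.filter_subset_filter _ (Finset.Icc_subset_Icc_right ?_))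
    exact add_le_add_left hab _
  · have hmem : monomial (a + faceExponent F) (1 : k) ∈
        Ideal.span {faceMonomial k F} ⊓ facetIdeal k (Δ.removeFacet F) :=
      ⟨(monomial_mem_span_faceMonomial_iff F _).mpr (by simp),
        (monomial_mem_facetIdeal_iff _ _).mpr ha⟩
    obtain ⟨w, hwa, hw⟩ := exists_minimal_le_of_wellFoundedLT
      (fun b => monomial b (1 : k) ∈
        Ideal.span {faceMonomial k F} ⊓ facetIdeal k (Δ.removeFacet F)) _ hmem
    have hwS : w ∈ S a := Finset.mem_filter.mpr ⟨Finset.mem_Icc.mpr ⟨zero_le, hwa⟩, hw⟩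
    have hψ : Minimal (fun b => monomial b (1 : k) ∈ facetIdeal k (Δ.removeFacet F)) (ψ w) :=
      (hgen w hw).2
    refine ⟨isUpperSet_facetUpset _ (Finset.le_sup hwS) ?_, ?_⟩
    · exact (monomial_mem_facetIdeal_iff _ _).mp hψ.prop
    · refine (hlt (S a) ⟨w, hwS⟩ fun b hb => (Finset.mem_filter.mp hb).2).2.trans_le ?_
      exact Finset.sup_le fun b hb => (Finset.mem_Icc.mp (Finset.mem_filter.mp hb).1).2

/-! ### Counting basis elements -/

namespace Frame

variable {U₁ U₂ : Set (V →₀ ℕ)} {ι κ : Type} [Fintype ι] [Fintype κ]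

theorem count_tensor [DecidableEq ι] [DecidableEq κ] (C : Frame k U₁ ι) (D : Frame k U₂ κ)
    (h₁ : IsUpperSet U₁) (h₂ : IsUpperSet U₂)
    (hdisj : ∀ i j v, C.deg i v = 0 ∨ D.deg j v = 0) (n j : ℕ) :
    (C.tensor D h₁ h₂).count n j = ∑ l₁ ∈ Finset.range (n + 1), ∑ l₂ ∈ Finset.range (j + 1),
      C.count l₁ l₂ * D.count (n - l₁) (j - l₂) := by
  have hdeg : ∀ p : ι × κ, ((C.tensor D h₁ h₂).deg p).degree =
      (C.deg p.1).degree + (D.deg p.2).degree := by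
    intro p
    change (C.deg p.1 ⊔ D.deg p.2).degree = _
    rw [sup_eq_add_of_disjoint (hdisj _ _), map_add]
  have hhom : ∀ p : ι × κ, (C.tensor D h₁ h₂).homDeg p = C.homDeg p.1 + D.homDeg p.2 :=
    fun _ => rfl
  rw [← Finset.sum_product', count, Finset.card_eq_sum_card_fiberwise
    (f := fun p : ι × κ => (C.homDeg p.1, (C.deg p.1).degree))
    (t := Finset.range (n + 1) ×ˢ Finset.range (j + 1))]
  · refine Finset.sum_congr rfl fun l hl => ?_
    rw [Finset.mem_product, Finset.mem_range, Finset.mem_range] at hl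
    rw [count, count, ← Finset.card_product]
    congr 1
    ext p
    simp only [Finset.mem_filter, Finset.mem_univ, true_and, Finset.mem_product, hdeg, hhom,
      Prod.ext_iff]
    omega
  · intro p hp
    have := (Finset.mem_filter.mp (Finset.mem_coe.mp hp)).2
    rw [hdeg, hhom] at this
    simp only [Finset.coe_product, Set.mem_prod, Finset.mem_coe, Finset.mem_range]
    omega

theorem count_cone {U : Set (V →₀ ℕ)} (C : Frame k U₁ κ) (D : Frame k U₂ ι) (m : V →₀ ℕ)
    (E : Frame k U (κ ⊕ ι)) (hhom : E.homDeg = Sum.elim C.homDeg (fun i => D.homDeg i + 1))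
    (hdeg : E.deg = Sum.elim C.deg (fun i => D.deg i + m)) (n j : ℕ) :
    E.count (n + 1) j =
      C.count (n + 1) j + if m.degree ≤ j then D.count n (j - m.degree) else 0 := by
  rw [count, Finset.card_filter, Fintype.sum_sum_type, ← Finset.card_filter,
    ← Finset.card_filter]
  congr 1
  · simp only [hhom, hdeg, Sum.elim_inl]
    rfl
  · simp only [hhom, hdeg, Sum.elim_inr, map_add]
    split_ifs with h
    · rw [count]
      congr 1
      ext a
      simp only [Finset.mem_filter, Finset.mem_univ, true_and]
      omega
    · rw [Finset.card_eq_zero, Finset.filter_eq_empty_iff]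
      intro a _
      omega

end Frame

end MonomialSplitting

theorem theorem5p5 {V : Type*} [Fintype V] [DecidableEq V] (k : Type*) [Field k]
    (Δ : PreAbstractSimplicialComplex V) (F : Finset V)
    (hF : MonomialSplitting.IsSplittingFacet k Δ F) (i j : ℕ) (hi : 1 ≤ i) :
    GradedResolution.gradedBetti (MonomialSplitting.facetIdeal k Δ) i j =
      GradedResolution.gradedBetti (MonomialSplitting.facetIdeal k (Δ.removeFacet F)) i j +
      ∑ l₁ ∈ Finset.range (i + 1), ∑ l₂ ∈ Finset.range (j + 1 - F.card),
        GradedResolution.extBetti (MonomialSplitting.facetIdeal k (Δ.reducedConn F))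
            ((l₁ : ℤ) - 1) l₂ *
          GradedResolution.extBetti
            (MonomialSplitting.facetIdeal k (Δ.removeSubcomplex (Δ.conn F)))
            ((i : ℤ) - l₁ - 1) (j - F.card - l₂) := by
  classical
  open MonomialSplitting PreAbstractSimplicialComplex in
  obtain ⟨κ, _, K, hK, -⟩ := exists_facet_frame k (Δ.removeFacet F)
  obtain ⟨ι₁, _, A, hA, hAdeg⟩ := exists_facet_frame k (Δ.reducedConn F)
  obtain ⟨ι₂, _, B, hB, hBdeg⟩ := exists_facet_frame k (Δ.removeSubcomplex (Δ.conn F))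
  have hdisj : ∀ i₁ i₂ v, A.deg i₁ v = 0 ∨ B.deg i₂ v = 0 := by
    intro i₁ i₂ v
    by_contra! h
    obtain ⟨H, hH, hvH⟩ := hAdeg i₁ v h.1
    obtain ⟨G, hG, hvG⟩ := hBdeg i₂ v h.2
    rw [isFacet_reducedConn_iff hF.1] at hH
    obtain ⟨G', ⟨hG', hFG', -⟩, rfl⟩ := hH.prop
    rw [isFacet_removeSubcomplex_conn_iff] at hG
    exact Finset.disjoint_left.mp (FacetsConnected.disjoint hG' hG.1 hFG' hG.2)
      (Finset.mem_sdiff.mp hvH).1 hvG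
  obtain ⟨c, hmono, hc⟩ := exists_degree_bound hF
  have hU := mem_facetUpset_reducedConn_union_iff hF.1
  obtain ⟨E, hE, hEhom, hEdeg⟩ := K.exists_minimal_cone
    (A.tensor B (isUpperSet_facetUpset _) (isUpperSet_facetUpset _)) hK
    (hA.tensor hB _ _ hdisj) (faceExponent F) (faceExponent_ne_zero hF.1.nonempty)
    (isUpperSet_facetUpset _) hU c hmono (fun a ha => (hc a ((hU a).mp ha)).1)
    (fun a ha => (hc a ((hU a).mp ha)).2)
  have hEU : IsUpperSet (facetUpset (Δ.removeFacet F) ∪ Set.Ici (faceExponent F)) := by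
    rw [← facetUpset_eq_union hF.1]
    exact isUpperSet_facetUpset Δ
  rw [E.gradedBetti_eq_count hE hEU _ (by
      rw [← facetUpset_eq_union hF.1]
      exact mem_facetIdeal_iff Δ),
    K.gradedBetti_eq_count hK (isUpperSet_facetUpset _) _ (mem_facetIdeal_iff _),
    Frame.count_cone K _ _ E hEhom hEdeg, degree_faceExponent]
  congr 1
  split_ifs with hFj
  · rw [Frame.count_tensor A B _ _ hdisj, Nat.sub_add_comm hFj]
    refine Finset.sum_congr rfl fun l₁ hl₁ => Finset.sum_congr rfl fun l₂ _ => ?_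
    rw [A.extBetti_eq_count hA (isUpperSet_facetUpset _) _ (mem_facetIdeal_iff _),
      ← Nat.cast_sub (Finset.mem_range_succ_iff.mp hl₁),
      B.extBetti_eq_count hB (isUpperSet_facetUpset _) _ (mem_facetIdeal_iff _)]
  · rw [show j + 1 - F.card = 0 by omega]
    simp
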